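/- A coherent configuration on a finite set $\Omega$ is a pair $\mathcal X=(\Omega,S)$, where $S$ is a partition of $\Omega\times\Omega$ into nonempty sets, called basis relations, such that (C1) the diagonal $\{(\alpha,\alpha):\alpha\in\Omega\}$ is a union of basis relations; (C2) for every $s\in S$ the transposed relation $s^*=\{(\alpha,\beta):(\beta,\alpha)\in s\}$ belongs to $S$; (C3) for all $r,s,t\in S$ the number $c_{rs}^t=|\{\gamma\in\Omega:(\alpha,\gamma)\in r,\ (\gamma,\beta)\in s\}|$ does not depend on the choice of $(\alpha,\beta)\in t$. For coherent configurations on the same set, $\mathcal X\le\mathcal X'$ means that every basis relation of $\mathcal X$ is a union of basis relations of $\mathcal X'$. For a set $T$ of binary relations on $\Omega$, $\mathrm{WL}(T)$ denotes the smallest coherent configuration on $\Omega$ for which every relation of $T$ is a union of basis relations. An algebraic isomorphism from $(\Omega,S)$ to $(\Omega',S')$ is a bijection $\varphi:S\to S'$ such that $c_{rs}^t=c_{\varphi(r)\varphi(s)}^{\varphi(t)}$ for all $r,s,t\in S$. A combinatorial isomorphism is a bijection $f:\Omega\to\Omega'$ such that $s^f=\{(f(\alpha),f(\beta)):(\alpha,\beta)\in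 s\}\in S'$ for all $s\in S$; it induces the algebraic isomorphism $s\mapsto s^f$. A coherent configuration is separable if every algebraic isomorphism from it to any coherent configuration (on any finite set) is induced by a combinatorial isomorphism. A finite simple graph is chordal bipartite if it is bipartite and contains no induced cycle of length at least $6$. It is $T_2$-free if it does not contain, as an induced subgraph, the bipartite claw $T_2$, that is, the tree on seven vertices obtained from the claw $K_{1,3}$ by subdividing each edge once. Theorem. Let $X$ be a finite connected chordal bipartite $T_2$-free graph with arc set $D$ (the set of ordered pairs of adjacent vertices), and let $\alpha$ be any vertex of $X$. Then the coherent configuration $\mathrm{WL}(X_\alpha)=\mathrm{WL}(\{D,\{(\alpha,\alpha)\}\})$ of the graph $X$ with distinguished vertex $\alpha$ is separable. -/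

import Mathlib

universe u v

/-- For binary relations `r`, `s` on `Ω` and a pair `p = (α, β)`, the number
`|α r ∩ β s*|` of all `γ` such that `(α, γ) ∈ r` and `(γ, β) ∈ s`. -/
noncomputable def pathCount {Ω : Type u} (r s : Set (Ω × Ω)) (p : Ω × Ω) : ℕ :=
  Set.ncard {γ : Ω | (p.1, γ) ∈ r ∧ (γ, p.2) ∈ s}

/-- A coherent configuration on a finite set `Ω`: a partition `S` of `Ω × Ω` into
nonempty basis relations satisfying (C1) the diagonal is a union of basis relations, (C2) `S` is
closed under transposition, (C3) the number `c_{rs}^t = |α r ∩ β s*|` does not depend on the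
choice of `(α, β) ∈ t`. -/
structure CoherentConfiguration (Ω : Type u) [Finite Ω] where
  /-- The set of basis relations. -/
  S : Set (Set (Ω × Ω))
  isPartition : Setoid.IsPartition S
  diagonal : ∃ T ⊆ S, {p : Ω × Ω | p.1 = p.2} = ⋃₀ T
  transpose : ∀ s ∈ S, {p : Ω × Ω | (p.2, p.1) ∈ s} ∈ S
  coherent : ∀ r ∈ S, ∀ s ∈ S, ∀ t ∈ S, ∀ p ∈ t, ∀ q ∈ t, pathCount r s p = pathCount r s q

namespace CoherentConfiguration

/-- The relation `R` is a union of basis relations of `𝒳`. -/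
def IsUnionOfBasis {Ω : Type u} [Finite Ω] (𝒳 : CoherentConfiguration Ω)
    (R : Set (Ω × Ω)) : Prop :=
  ∃ T ⊆ 𝒳.S, R = ⋃₀ T

/-- `𝒳 ≤ 𝒴` if each basis relation of `𝒳` is a union of basis relations of `𝒴`. -/
instance {Ω : Type u} [Finite Ω] : LE (CoherentConfiguration Ω) where
  le 𝒳 𝒴 := ∀ s ∈ 𝒳.S, 𝒴.IsUnionOfBasis s

/-- The equivalence relation on `Ω × Ω` whose classes are the basis relations. -/
def toSetoid {Ω : Type u} [Finite Ω] (𝒳 : CoherentConfiguration Ω) : Setoid (Ω × Ω) :=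
  Setoid.mkClasses 𝒳.S 𝒳.isPartition.2

theorem classes_toSetoid {Ω : Type u} [Finite Ω] (𝒳 : CoherentConfiguration Ω) :
    𝒳.toSetoid.classes = 𝒳.S :=
  Setoid.classes_mkClasses 𝒳.S 𝒳.isPartition

/-- `R` is a union of classes of an equivalence relation iff it is saturated. -/
theorem exists_sUnion_classes_iff {A : Type u} (e : Setoid A) (R : Set A) :
    (∃ T ⊆ e.classes, R = ⋃₀ T) ↔ ∀ p q, e p q → p ∈ R → q ∈ R := by
  constructor
  · rintro ⟨T, hT, rfl⟩ p q hpq ⟨s, hs, hps⟩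
    obtain ⟨y, rfl⟩ := hT hs
    exact ⟨_, hs, e.trans (e.symm hpq) hps⟩
  · intro h
    refine ⟨{s | s ∈ e.classes ∧ s ⊆ R}, fun s hs => hs.1, Set.Subset.antisymm ?_ ?_⟩
    · intro p hp
      exact ⟨{x | e x p}, ⟨⟨p, rfl⟩, fun x hx => h p x (e.symm hx) hp⟩, e.refl p⟩
    · rintro p ⟨s, hs, hps⟩
      exact hs.2 hps

theorem isUnionOfBasis_iff {Ω : Type u} [Finite Ω] (𝒳 : CoherentConfiguration Ω)
    (R : Set (Ω × Ω)) :
    𝒳.IsUnionOfBasis R ↔ ∀ p q, 𝒳.toSetoid p q → p ∈ R → q ∈ R := by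
  rw [← exists_sUnion_classes_iff, classes_toSetoid]
  rfl

theorem le_iff_toSetoid_le {Ω : Type u} [Finite Ω] (𝒳 𝒴 : CoherentConfiguration Ω) :
    𝒳 ≤ 𝒴 ↔ 𝒴.toSetoid ≤ 𝒳.toSetoid := by
  constructor
  · intro h p q hpq
    have hs : {x | 𝒳.toSetoid x p} ∈ 𝒳.S := by
      rw [← classes_toSetoid]; exact ⟨p, rfl⟩
    exact 𝒳.toSetoid.symm
      ((isUnionOfBasis_iff 𝒴 _).1 (h _ hs) p q hpq (𝒳.toSetoid.refl p))
  · intro h s hs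
    rw [← classes_toSetoid] at hs
    obtain ⟨y, rfl⟩ := hs
    rw [isUnionOfBasis_iff]
    intro p q hpq hp
    exact 𝒳.toSetoid.trans (𝒳.toSetoid.symm (h hpq)) hp

/-- The order `≤` is a partial order. -/
instance {Ω : Type u} [Finite Ω] : PartialOrder (CoherentConfiguration Ω) where
  le_refl 𝒳 := (le_iff_toSetoid_le _ _).2 le_rfl
  le_trans 𝒳 𝒴 𝒵 h k := (le_iff_toSetoid_le _ _).2
    (((le_iff_toSetoid_le _ _).1 k).trans ((le_iff_toSetoid_le _ _).1 h))
  le_antisymm 𝒳 𝒴 h k := by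
    have e : 𝒳.toSetoid = 𝒴.toSetoid :=
      le_antisymm ((le_iff_toSetoid_le _ _).1 k) ((le_iff_toSetoid_le _ _).1 h)
    have hS : 𝒳.S = 𝒴.S := by rw [← classes_toSetoid, ← classes_toSetoid, e]
    cases 𝒳
    cases 𝒴
    simp only at hS
    subst hS
    rfl

/-- Coherence extends from basis relations to unions of basis relations. -/
theorem pathCount_eq {Ω : Type u} [Finite Ω] (𝒳 : CoherentConfiguration Ω)
    {r s : Set (Ω × Ω)} (hr : ∀ p q, 𝒳.toSetoid p q → p ∈ r → q ∈ r)
    (hs : ∀ p q, 𝒳.toSetoid p q → p ∈ s → q ∈ s) {p q : Ω × Ω} (hpq : 𝒳.toSetoid p q) :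
    pathCount r s p = pathCount r s q := by
  classical
  have := Fintype.ofFinite Ω
  let c : Ω × Ω → Set (Ω × Ω) := fun x => {y | 𝒳.toSetoid y x}
  have hc : ∀ x y, y ∈ c x ↔ c y = c x := by
    intro x y
    constructor
    · intro h
      ext z
      exact ⟨fun hz => 𝒳.toSetoid.trans hz h, fun hz => 𝒳.toSetoid.trans hz (𝒳.toSetoid.symm h)⟩
    · intro h
      rw [← h]
      exact 𝒳.toSetoid.refl y
  have hcS : ∀ x, c x ∈ 𝒳.S := by
    intro x
    rw [← classes_toSetoid]
    exact ⟨x, rfl⟩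
  let f : Ω × Ω → Ω → Set (Ω × Ω) × Set (Ω × Ω) := fun x γ => (c (x.1, γ), c (γ, x.2))
  let A : Ω × Ω → Finset Ω := fun x => {γ | (x.1, γ) ∈ r ∧ (γ, x.2) ∈ s}
  have hA : ∀ x, pathCount r s x = (A x).card := by
    intro x
    rw [pathCount, ← Set.ncard_coe_finset]
    congr 1
    ext γ
    simp [A]
  have hsum : ∀ x, (A x).card = ∑ d, ({γ ∈ A x | f x γ = d} : Finset Ω).card := fun x =>
    Finset.card_eq_sum_card_fiberwise (t := Finset.univ) (fun _ _ => by simp)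
  rw [hA, hA, hsum, hsum]
  refine Finset.sum_congr rfl fun d _ => ?_
  by_cases hd : ∃ a ∈ r, ∃ b ∈ s, d = (c a, c b)
  · obtain ⟨a, ha, b, hb, rfl⟩ := hd
    have hterm : ∀ x, ({γ ∈ A x | f x γ = (c a, c b)} : Finset Ω).card =
        pathCount (c a) (c b) x := by
      intro x
      rw [pathCount, ← Set.ncard_coe_finset]
      congr 1
      ext γ
      simp only [Finset.coe_filter, Set.mem_ofPred_eq, A, f, Finset.mem_filter, Finset.mem_univ,
        true_and, Prod.mk.injEq]
      rw [hc, hc]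
      constructor
      · exact fun h => h.2
      · intro h
        exact ⟨⟨hr _ _ (𝒳.toSetoid.symm ((hc _ _).2 h.1)) ha,
          hs _ _ (𝒳.toSetoid.symm ((hc _ _).2 h.2)) hb⟩, h⟩
    rw [hterm, hterm]
    exact 𝒳.coherent _ (hcS a) _ (hcS b) _ (hcS q) p hpq q (𝒳.toSetoid.refl q)
  · have hterm : ∀ x, ({γ ∈ A x | f x γ = d} : Finset Ω) = ∅ := by
      intro x
      ext γ
      simp only [A, Finset.mem_filter, Finset.mem_univ, true_and, Finset.notMem_empty, iff_false]
      rintro ⟨⟨h1, h2⟩, h3⟩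
      exact hd ⟨_, h1, _, h2, h3.symm⟩
    rw [hterm, hterm]

/-- Transposition respects the equivalence relation of a coherent configuration. -/
theorem toSetoid_swap {Ω : Type u} [Finite Ω] (𝒳 : CoherentConfiguration Ω) {p q : Ω × Ω}
    (h : 𝒳.toSetoid p q) : 𝒳.toSetoid p.swap q.swap := by
  have hs : {x | 𝒳.toSetoid x q} ∈ 𝒳.S := by rw [← classes_toSetoid]; exact ⟨q, rfl⟩
  have ht := 𝒳.transpose _ hs
  rw [← classes_toSetoid] at ht
  exact Setoid.rel_iff_exists_classes _ |>.2 ⟨_, ht, h, 𝒳.toSetoid.refl q⟩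

/-- Induction along a supremum of equivalence relations of coherent configurations. -/
theorem sSup_induction {Ω : Type u} [Finite Ω] (C : Set (CoherentConfiguration Ω))
    {P : Ω × Ω → Ω × Ω → Prop} (hP : Equivalence P)
    (h : ∀ 𝒳 ∈ C, ∀ p q, 𝒳.toSetoid p q → P p q) {p q : Ω × Ω}
    (hpq : sSup (toSetoid '' C) p q) : P p q := by
  have hle : sSup (toSetoid '' C) ≤ (⟨P, hP⟩ : Setoid (Ω × Ω)) := by
    refine sSup_le ?_
    rintro _ ⟨𝒳, h𝒳, rfl⟩ p q hpq
    exact h 𝒳 h𝒳 p q hpq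
  exact hle hpq

theorem sSup_saturated {Ω : Type u} [Finite Ω] (C : Set (CoherentConfiguration Ω))
    {R : Set (Ω × Ω)} (h : ∀ 𝒳 ∈ C, ∀ p q, 𝒳.toSetoid p q → p ∈ R → q ∈ R) (p q : Ω × Ω)
    (hpq : sSup (toSetoid '' C) p q) (hp : p ∈ R) : q ∈ R := by
  refine (sSup_induction C (P := fun p q => p ∈ R ↔ q ∈ R)
    ⟨fun _ => Iff.rfl, Iff.symm, Iff.trans⟩ ?_ hpq).1 hp
  exact fun 𝒳 h𝒳 p q hpq => ⟨h 𝒳 h𝒳 p q hpq, h 𝒳 h𝒳 q p (𝒳.toSetoid.symm hpq)⟩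

theorem rel_sSup {Ω : Type u} [Finite Ω] {C : Set (CoherentConfiguration Ω)}
    {𝒳 : CoherentConfiguration Ω} (h : 𝒳 ∈ C) {p q : Ω × Ω} (hpq : 𝒳.toSetoid p q) :
    sSup (toSetoid '' C) p q := by
  have hle : 𝒳.toSetoid ≤ sSup (toSetoid '' C) := le_sSup (Set.mem_image_of_mem _ h)
  exact hle hpq

/-- The coherent closure `WL(T)` of a set `T` of binary relations on `Ω`: the partition of `Ω × Ω`
into the classes of the join of the equivalence relations of all coherent configurations for which
each relation of `T` is a union of basis relations. By `isLeast_coherentClosure` it is the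
smallest coherent configuration with this property. -/
def coherentClosure {Ω : Type u} [Finite Ω] (T : Set (Set (Ω × Ω))) :
    CoherentConfiguration Ω :=
  let e : Setoid (Ω × Ω) :=
    sSup (toSetoid '' {𝒳 : CoherentConfiguration Ω | ∀ R ∈ T, 𝒳.IsUnionOfBasis R})
  { S := e.classes
    isPartition := Setoid.isPartition_classes e
    diagonal := (exists_sUnion_classes_iff e _).2
      (sSup_saturated _ fun 𝒳 _ => (isUnionOfBasis_iff 𝒳 _).1 𝒳.diagonal)
    transpose := by
      have hsymm : ∀ p q, e p q → e p.swap q.swap := by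
        intro p q hpq
        refine sSup_induction (P := fun p q => e p.swap q.swap) _ ⟨fun _ => e.refl _,
          e.symm, e.trans⟩ ?_ hpq
        intro 𝒳 h𝒳 p q hpq
        exact rel_sSup h𝒳 (𝒳.toSetoid_swap hpq)
      rintro _ ⟨y, rfl⟩
      refine ⟨y.swap, Set.ext fun p => ⟨fun h => ?_, fun h => ?_⟩⟩
      · exact hsymm _ _ h
      · exact hsymm _ _ h
    coherent := by
      rintro _ ⟨r, rfl⟩ _ ⟨s, rfl⟩ _ ⟨t, rfl⟩ p hp q hq
      have hsat : ∀ (𝒳 : CoherentConfiguration Ω), (∀ R ∈ T, 𝒳.IsUnionOfBasis R) →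
          ∀ r p q, 𝒳.toSetoid p q → p ∈ {x | e x r} → q ∈ {x | e x r} := by
        intro 𝒳 h𝒳 r p q hpq hp
        exact e.trans (e.symm (rel_sSup (C := {𝒳 | ∀ R ∈ T, 𝒳.IsUnionOfBasis R}) h𝒳 hpq)) hp
      refine sSup_induction (P := fun p q => pathCount {x | e x r} {x | e x s} p =
        pathCount {x | e x r} {x | e x s} q) _ ⟨fun _ => rfl, Eq.symm, Eq.trans⟩ ?_
        (e.trans hp (e.symm hq))
      intro 𝒳 h𝒳 p q hpq
      exact 𝒳.pathCount_eq (hsat 𝒳 h𝒳 r) (hsat 𝒳 h𝒳 s) hpq }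

theorem isLeast_coherentClosure {Ω : Type u} [Finite Ω] (T : Set (Set (Ω × Ω))) :
    IsLeast {𝒳 : CoherentConfiguration Ω | ∀ R ∈ T, 𝒳.IsUnionOfBasis R} (coherentClosure T) := by
  constructor
  · intro R hR
    exact (exists_sUnion_classes_iff _ _).2
      (sSup_saturated _ fun 𝒳 h𝒳 => (isUnionOfBasis_iff 𝒳 _).1 (h𝒳 R hR))
  · intro 𝒳 h𝒳 s hs
    obtain ⟨y, rfl⟩ := hs
    rw [isUnionOfBasis_iff]
    intro p q hpq hp
    exact Setoid.trans' _ (Setoid.symm' _ (rel_sSup h𝒳 hpq)) hp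

/-- A combinatorial isomorphism: a bijection of the underlying sets mapping each basis relation
to a basis relation. -/
def IsCombinatorialIso {Ω : Type u} {Ω' : Type v} [Finite Ω] [Finite Ω']
    (𝒳 : CoherentConfiguration Ω) (𝒳' : CoherentConfiguration Ω') (f : Ω ≃ Ω') : Prop :=
  ∀ s ∈ 𝒳.S, Prod.map f f '' s ∈ 𝒳'.S

/-- An algebraic isomorphism: a bijection `φ : S → S'` between the sets of basis relations
preserving the intersection numbers, `c_{rs}^t = c_{φ(r)φ(s)}^{φ(t)}`. Here the intersection
numbers are computed at arbitrary representatives `p ∈ t` and `q ∈ φ(t)`. -/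
def IsAlgebraicIso {Ω : Type u} {Ω' : Type v} [Finite Ω] [Finite Ω']
    (𝒳 : CoherentConfiguration Ω) (𝒳' : CoherentConfiguration Ω') (φ : 𝒳.S ≃ 𝒳'.S) : Prop :=
  ∀ r s t : 𝒳.S, ∀ p ∈ t.1, ∀ q ∈ (φ t).1,
    pathCount r.1 s.1 p = pathCount (φ r).1 (φ s).1 q

/-- A coherent configuration is separable if every algebraic isomorphism from it to another
coherent configuration is induced by a combinatorial isomorphism. -/
def IsSeparable {Ω : Type u} [Finite Ω] (𝒳 : CoherentConfiguration Ω) : Prop :=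
  ∀ (Ω' : Type v) [Finite Ω'] (𝒳' : CoherentConfiguration Ω') (φ : 𝒳.S ≃ 𝒳'.S),
    IsAlgebraicIso 𝒳 𝒳' φ →
      ∃ f : Ω ≃ Ω', IsCombinatorialIso 𝒳 𝒳' f ∧ ∀ s : 𝒳.S, (φ s).1 = Prod.map f f '' s.1

end CoherentConfiguration

/-- The coherent configuration `WL(X_α)` of the graph `X` with distinguished vertex `α`: the
coherent closure of the arc set of `X` and the relation `{(α, α)}`. -/
def SimpleGraph.WL {Ω : Type u} [Finite Ω] (X : SimpleGraph Ω) (α : Ω) :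
    CoherentConfiguration Ω :=
  CoherentConfiguration.coherentClosure {{p : Ω × Ω | X.Adj p.1 p.2}, {(α, α)}}

/-- A graph is chordal bipartite if it is bipartite and contains no induced cycle of length at
least `6`. -/
def SimpleGraph.IsChordalBipartite {Ω : Type u} (X : SimpleGraph Ω) : Prop :=
  X.IsBipartite ∧ ∀ n : ℕ, 6 ≤ n → ¬ (SimpleGraph.cycleGraph n).IsIndContained X

/-- The bipartite claw `T₂`: the tree on seven vertices obtained from the claw with center `0` and
leaves `1, 2, 3` by subdividing each edge once, that is, by attaching pendant vertices `4, 5, 6` to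
`1, 2, 3`, respectively. -/
def bipartiteClaw : SimpleGraph (Fin 7) :=
  SimpleGraph.fromEdgeSet {s(0, 1), s(0, 2), s(0, 3), s(1, 4), s(2, 5), s(3, 6)}

/-! Consider the fibers of $\mathrm{WL}(X_\alpha)$. They form an equitable partition of the vertices
in which $\alpha$ is alone, so distance from $\alpha$ is constant on each fiber and fibers are
independent sets.

The structure of $X$ between fibers comes from three facts. By chordality and equal degrees, the
graph between two fibers is a disjoint union of complete bipartite graphs
(`IsEquitable.adj_of_common_neighbor`). By $T_2$-freeness there are at most two of them
(`atMostTwo_of_adj`). If there are two, vertices of a fiber in the same component are twins in all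
of $X$, since otherwise two crossing halvings of the fiber give an induced 8-cycle
(`adj_of_not_complete`). Hence a fiber carries at most two neighborhoods (`neighborSet_eq_or`).

Call two fibers linked if the graph between them is neither empty nor complete. For a fixed point
$x$, the choice between the two neighborhoods propagates along links: in the link class of $x$ the
basis relation of $(x,y)$ determines the neighborhood of $y$ (`neighborSet_eq_of_linkSetoid`).

Given an algebraic isomorphism $\varphi$, choose a basepoint in each link class and an image for it,
and build a bijection $f$ that follows $\varphi$ on the pairs (basepoint, $y$). Then $f$ is
compatible with adjacency: inside a link class because the basepoint determines neighborhoods,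
between link classes because adjacency there is all or nothing. Minimality of the coherent closure
upgrades this to $f$ inducing $\varphi$ (`cell_eq_of_coherentClosure`). -/

namespace SimpleGraph

/-! ### Induced cycles and induced bipartite claws. -/

/-- The spanning subgraph of `X` consisting of the edges inside `T`. -/
def restrictTo {Ω : Type u} (X : SimpleGraph Ω) (T : Set Ω) : SimpleGraph Ω where
  Adj x y := X.Adj x y ∧ x ∈ T ∧ y ∈ T
  symm := ⟨fun _ _ h => ⟨h.1.symm, h.2.2, h.2.1⟩⟩
  loopless := ⟨fun _ h => X.loopless.irrefl _ h.1⟩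

theorem val_sub_eq_one_iff {n : ℕ} (hn : 2 ≤ n) (a b : Fin n) :
    (a - b).val = 1 ↔ a.val = b.val + 1 ∨ a.val = 0 ∧ b.val + 1 = n := by
  have ha := a.isLt
  have hb := b.isLt
  rw [Fin.sub_def]
  simp only
  rcases le_or_gt b.val a.val with h | h
  · have : n - b.val + a.val = (a.val - b.val) + n := by omega
    rw [this, Nat.add_mod_right, Nat.mod_eq_of_lt (by omega)]
    omega
  · rw [Nat.mod_eq_of_lt (by omega)]
    omega

/-- The vertex `c` closes the induced path `p 0, …, p l` and takes the last index `l + 1` of the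
cycle. -/
theorem isIndContained_cycleGraph_of_path {Ω : Type u} {X : SimpleGraph Ω} {l : ℕ} (hl : 2 ≤ l)
    (p : ℕ → Ω) (c : Ω) (hadj : ∀ i j, i < j → j ≤ l → (X.Adj (p i) (p j) ↔ j = i + 1))
    (hne : ∀ i j, i < j → j ≤ l → p i ≠ p j)
    (hc : ∀ i, i ≤ l → (X.Adj c (p i) ↔ i = 0 ∨ i = l)) (hcne : ∀ i, i ≤ l → p i ≠ c) :
    (cycleGraph (l + 2)).IsIndContained X := by
  let F : Fin (l + 2) → Ω := fun i => if i.val ≤ l then p i.val else c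
  have hF1 : ∀ i : Fin (l + 2), i.val ≤ l → F i = p i.val := fun i hi => if_pos hi
  have hF2 : ∀ i : Fin (l + 2), ¬ i.val ≤ l → F i = c := fun i hi => if_neg hi
  have key : ∀ i j : Fin (l + 2), i.val < j.val →
      F i ≠ F j ∧ (X.Adj (F i) (F j) ↔ (cycleGraph (l + 2)).Adj i j) := by
    intro i j hij
    have hj := j.isLt
    have hi' : i.val ≤ l := by omega
    rw [cycleGraph_adj', val_sub_eq_one_iff (by omega), val_sub_eq_one_iff (by omega), hF1 i hi']
    by_cases hjl : j.val ≤ l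
    · rw [hF1 j hjl, hadj _ _ hij hjl]
      exact ⟨hne _ _ hij hjl, by omega⟩
    · rw [hF2 j hjl, X.adj_comm, hc _ hi']
      exact ⟨hcne _ hi', by omega⟩
  refine ⟨⟨⟨F, ?_⟩, ?_⟩⟩
  · intro i j h
    by_contra hij
    rcases lt_or_gt_of_ne (fun h => hij (Fin.ext h)) with h1 | h1
    · exact (key i j h1).1 h
    · exact (key j i h1).1 h.symm
  · intro i j
    change X.Adj (F i) (F j) ↔ _
    rcases lt_trichotomy i.val j.val with h1 | h1 | h1
    · exact (key i j h1).2
    · rw [Fin.ext h1]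
      simp
    · rw [X.adj_comm, (cycleGraph (l + 2)).adj_comm]
      exact (key j i h1).2

theorem IsBipartite.exists_coloring_bool {Ω : Type u} {X : SimpleGraph Ω} (h : X.IsBipartite) :
    Nonempty (X.Coloring Bool) :=
  ⟨recolorOfEquiv X finTwoEquiv h.some⟩

/-- In a chordal bipartite graph, if two neighbors of `c` are joined by a path with inner vertices
in a set `S` of non-neighbors of `c`, then they have a common neighbor in `S`. -/
theorem IsChordalBipartite.exists_common_neighbor {Ω : Type u} {X : SimpleGraph Ω}
    (hX : X.IsChordalBipartite) {c a b : Ω} {S : Set Ω} (hca : X.Adj c a) (hcb : X.Adj c b)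
    (hab : a ≠ b) (hS : ∀ s ∈ S, ¬ X.Adj c s ∧ s ≠ c)
    (hreach : (X.restrictTo (insert a (insert b S))).Reachable a b) :
    ∃ s ∈ S, X.Adj s a ∧ X.Adj s b := by
  obtain ⟨col⟩ := IsBipartite.exists_coloring_bool hX.1
  set G := X.restrictTo (insert a (insert b S)) with hG
  obtain ⟨w, hw⟩ := hreach.exists_walk_length_eq_dist
  set l := w.length with hl
  let colG : G.Coloring Bool := Coloring.mk col fun h => col.valid h.1
  have hcol : col a = col b := by
    have h1 := col.valid hca
    have h2 := col.valid hcb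
    revert h1 h2
    cases col a <;> cases col b <;> cases col c <;> simp
  have heven : Even l := by
    rw [hl, colG.even_length_iff_congr w]
    change col a = true ↔ col b = true
    rw [hcol]
  have hr : ∀ i, G.Reachable a (w.getVert i) := fun i => (w.take i).reachable
  have hr2 : ∀ i, G.Reachable (w.getVert i) b := fun i => (w.drop i).reachable
  -- The walk is geodesic, so its segments are too; this excludes both repetitions and chords.
  have hd : ∀ i j, i ≤ j → j ≤ l → j ≤ i + G.dist (w.getVert i) (w.getVert j) := by
    intro i j hij hj
    have h1 : G.dist a (w.getVert i) ≤ i := (dist_le (w.take i)).trans (by simp)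
    have h2 : G.dist (w.getVert j) b ≤ l - j := (dist_le (w.drop j)).trans (by simp [hl])
    have h3 := (hr i).dist_triangle_left b
    have h4 := (hr2 j).dist_triangle_right (w.getVert i)
    omega
  have hpos : 0 < l := by
    rw [hw]
    exact hreach.pos_dist_of_ne hab
  have hstep : ∀ i, i < l → G.Adj (w.getVert i) (w.getVert (i + 1)) := fun i hi =>
    w.adj_getVert_succ hi
  have hmem : ∀ i, i ≤ l → w.getVert i ∈ insert a (insert b S) := by
    intro i hi
    rcases Nat.lt_or_ge i l with h | h
    · exact (hstep i h).2.1
    · have h := (hstep (l - 1) (by omega)).2.2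
      rwa [show l - 1 + 1 = i by omega] at h
  have h0 : w.getVert 0 = a := w.getVert_zero
  have hend : w.getVert l = b := w.getVert_length
  have hne : ∀ i j, i < j → j ≤ l → w.getVert i ≠ w.getVert j := by
    intro i j hij hj h
    have := hd i j hij.le hj
    rw [h, dist_self] at this
    omega
  have hin : ∀ i, 0 < i → i < l → w.getVert i ∈ S := by
    intro i hi hil
    rcases hmem i hil.le with h | h | h
    · exact absurd (h0.trans h.symm) (hne 0 i hi hil.le)
    · exact absurd (h.trans hend.symm) (hne i l hil le_rfl)
    · exact h
  obtain ⟨k, hk⟩ := heven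
  by_cases hl2 : l = 2
  · refine ⟨w.getVert 1, hin 1 one_pos (by omega), ?_, ?_⟩
    · have := (hstep 0 (by omega)).1
      rw [h0] at this
      exact this.symm
    · have := (hstep 1 (by omega)).1
      have h2 : w.getVert 2 = b := hl2 ▸ hend
      rwa [h2] at this
  -- The even length is now at least 4, and adding `c` gives an induced cycle of length at least 6.
  · refine absurd (isIndContained_cycleGraph_of_path (X := X) (l := l) (by omega) w.getVert c
      ?_ hne ?_ ?_) (hX.2 (l + 2) (by omega))
    · intro i j hij hj
      constructor
      · intro h
        have h2 : G.Adj (w.getVert i) (w.getVert j) := ⟨h, hmem i (by omega), hmem j hj⟩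
        have := hd i j hij.le hj
        rw [dist_eq_one_iff_adj.2 h2] at this
        omega
      · rintro rfl
        exact (hstep i (by omega)).1
    · intro i hi
      constructor
      · intro h
        by_contra hcon
        exact (hS _ (hin i (by omega) (by omega))).1 h
      · rintro (rfl | rfl)
        · rwa [h0]
        · rwa [hend]
    · intro i hi
      rcases Nat.eq_zero_or_pos i with rfl | h
      · rw [h0]; exact hca.ne'
      · rcases Nat.lt_or_ge i l with h' | h'
        · exact (hS _ (hin i h h')).2
        · rw [show i = l by omega, hend]; exact hcb.ne'

/-- Three neighbors of a vertex with private neighbors form an induced bipartite claw. -/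
theorem isIndContained_bipartiteClaw {Ω : Type u} {X : SimpleGraph Ω} (hX : X.IsBipartite)
    {c b₁ b₂ b₃ x₁ x₂ x₃ : Ω} (h₁ : X.Adj c b₁) (h₂ : X.Adj c b₂) (h₃ : X.Adj c b₃)
    (h₁₁ : X.Adj b₁ x₁) (h₂₂ : X.Adj b₂ x₂) (h₃₃ : X.Adj b₃ x₃)
    (h₁₂ : ¬ X.Adj b₁ x₂) (h₁₃ : ¬ X.Adj b₁ x₃) (h₂₁ : ¬ X.Adj b₂ x₁) (h₂₃ : ¬ X.Adj b₂ x₃)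
    (h₃₁ : ¬ X.Adj b₃ x₁) (h₃₂ : ¬ X.Adj b₃ x₂) : bipartiteClaw.IsIndContained X := by
  obtain ⟨col⟩ := IsBipartite.exists_coloring_bool hX
  have hc : ∀ {x y}, X.Adj x y → col y = !col x := by
    intro x y h
    have := col.valid h
    revert this
    cases col x <;> cases col y <;> simp
  have hn : ∀ {x y}, col x = col y → ¬ X.Adj x y := fun h h' => col.valid h' h
  have e1 := hc h₁
  have e2 := hc h₂
  have e3 := hc h₃
  have f1 : col x₁ = col c := by rw [hc h₁₁, e1, Bool.not_not]
  have f2 : col x₂ = col c := by rw [hc h₂₂, e2, Bool.not_not]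
  have f3 : col x₃ = col c := by rw [hc h₃₃, e3, Bool.not_not]
  let F : Fin 7 → Ω := ![c, b₁, b₂, b₃, x₁, x₂, x₃]
  have hF : ∀ i j, X.Adj (F i) (F j) ↔ bipartiteClaw.Adj i j := by
    intro i j
    have n1 : ∀ {x y}, col x = col c → col y = col c → ¬ X.Adj x y :=
      fun h h' => hn (h.trans h'.symm)
    have n2 : ∀ {x y}, (col x = !col c) → (col y = !col c) → ¬ X.Adj x y :=
      fun h h' => hn (h.trans h'.symm)
    fin_cases i <;> fin_cases j <;>
      simp [F, bipartiteClaw, h₁, h₂, h₃, h₁₁, h₂₂, h₃₃, h₁₂, h₁₃, h₂₁, h₂₃, h₃₁, h₃₂,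
        h₁.symm, h₂.symm, h₃.symm, h₁₁.symm, h₂₂.symm, h₃₃.symm,
        mt X.adj_symm h₁₂, mt X.adj_symm h₁₃, mt X.adj_symm h₂₁, mt X.adj_symm h₂₃, mt X.adj_symm h₃₁, mt X.adj_symm h₃₂,
        n1 rfl f1, n1 rfl f2, n1 rfl f3, n1 f1 rfl, n1 f2 rfl, n1 f3 rfl, n1 f1 f2, n1 f1 f3,
        n1 f2 f1, n1 f2 f3, n1 f3 f1, n1 f3 f2, n2 e1 e2, n2 e1 e3, n2 e2 e1, n2 e2 e3, n2 e3 e1,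
        n2 e3 e2]
  refine ⟨⟨⟨F, ?_⟩, fun {i j} => hF i j⟩⟩
  -- No two vertices of $T_2$ are twins, so a map preserving adjacency and non-adjacency is
  -- automatically injective; distinctness of the seven vertices need not be assumed.
  have hinj : ∀ i j : Fin 7, i ≠ j → ∃ k, ¬ (bipartiteClaw.Adj i k ↔ bipartiteClaw.Adj j k) := by
    simp only [bipartiteClaw, fromEdgeSet_adj, Set.mem_insert_iff, Set.mem_singleton_iff]
    decide
  intro i j h
  by_contra hij
  obtain ⟨k, hk⟩ := hinj i j hij
  exact hk (by rw [← hF, ← hF, h])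

end SimpleGraph

/-! ### Distance layers in chordal bipartite graphs. -/

namespace SimpleGraph

theorem Reachable.dist_le_dist_add_one {Ω : Type u} {G : SimpleGraph Ω} {r p q : Ω}
    (h : G.Reachable r p) (hpq : G.Adj p q) : G.dist r q ≤ G.dist r p + 1 := by
  have := h.dist_triangle_left q
  rwa [dist_eq_one_iff_adj.2 hpq] at this

/-- Distances from `r` to adjacent vertices differ in parity. Reachability matters: `dist` is 0
between different components. -/
theorem Reachable.dist_ne_of_adj {Ω : Type u} {G : SimpleGraph Ω} (hG : G.IsBipartite)
    {r p q : Ω} (h : G.Reachable r p) (hpq : G.Adj p q) : G.dist r p ≠ G.dist r q := by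
  obtain ⟨col⟩ := IsBipartite.exists_coloring_bool hG
  obtain ⟨w, hw⟩ := h.exists_walk_length_eq_dist
  obtain ⟨w', hw'⟩ := (h.trans hpq.reachable).exists_walk_length_eq_dist
  intro heq
  have h1 := col.even_length_iff_congr w
  have h2 := col.even_length_iff_congr w'
  rw [hw', ← heq, ← hw, h1] at h2
  have := col.valid hpq
  revert h2 this
  cases col p <;> cases col q <;> cases col r <;> simp

theorem Reachable.exists_adj_dist_eq {Ω : Type u} {G : SimpleGraph Ω} {r p : Ω} {n : ℕ}
    (h : G.Reachable r p) (hn : G.dist r p = n + 1) :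
    ∃ q, G.Adj q p ∧ G.Reachable r q ∧ G.dist r q = n := by
  obtain ⟨w, hw⟩ := h.exists_walk_length_eq_dist
  have hadj : G.Adj (w.getVert n) p := by
    have := w.adj_getVert_succ (i := n) (by omega)
    rwa [show n + 1 = w.length by omega, w.getVert_length] at this
  have hr : G.Reachable r (w.getVert n) := (w.take n).reachable
  refine ⟨_, hadj, hr, ?_⟩
  have h1 : G.dist r (w.getVert n) ≤ n := (dist_le (w.take n)).trans (by simp)
  have h2 := hr.dist_le_dist_add_one hadj
  omega

/-- All vertices of a geodesic from `a` to the root other than `a` are strictly closer to the root.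
-/
theorem reachable_restrictTo_root {Ω : Type u} {G : SimpleGraph Ω} {r : Ω} {T : Set Ω} (n : ℕ) :
    ∀ a, G.Reachable r a → G.dist r a = n → a ∈ T →
      (∀ v, G.Reachable r v → G.dist r v < n → v ∈ T) → (G.restrictTo T).Reachable a r := by
  induction n with
  | zero =>
    intro a ha h0 _ _
    rw [ha.dist_eq_zero_iff.1 h0]
  | succ n ih =>
    intro a ha hn haT hT
    obtain ⟨q, hqa, hq, hqn⟩ := ha.exists_adj_dist_eq hn
    have hqT := hT q hq (by omega)
    have : (G.restrictTo T).Adj a q := ⟨hqa.symm, haT, hqT⟩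
    exact this.reachable.trans (ih q hq hqn hqT fun v hv hvn => hT v hv (by omega))

/-- The lower neighborhoods of two lower neighbors of a vertex are comparable. -/
theorem IsChordalBipartite.lower_neighbors_comparable {Ω : Type u} {G : SimpleGraph Ω}
    (hG : G.IsChordalBipartite) {r w p q a b : Ω} {n : ℕ} (hpw : G.Adj p w) (hqw : G.Adj q w)
    (hap : G.Adj a p) (hbq : G.Adj b q) (hra : G.Reachable r a) (ha : G.dist r a = n)
    (hb : G.dist r b = n) (hp : G.dist r p = n + 1) (hq : G.dist r q = n + 1)
    (hw : G.dist r w = n + 2) : G.Adj a q ∨ G.Adj b p := by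
  by_contra! hcon
  obtain ⟨haq, hbp⟩ := hcon
  have hrp := hra.trans hap.reachable
  have hrq := (hrp.trans hpw.reachable).trans hqw.symm.reachable
  have hrb := hrq.trans hbq.symm.reachable
  -- The detour from `a` through the root to `b`, `q`, `w` meets the neighborhood of `p` only in `a`
  -- and `w`. A common neighbor of `a` and `w` on it could only be `q`, since the other points lie
  -- too low to reach `w`.
  let S : Set Ω := {v | (G.Reachable r v ∧ G.dist r v < n) ∨ v = b ∨ v = q}
  have hbS : b ∈ S := Or.inr (Or.inl rfl)
  have hqS : q ∈ S := Or.inr (Or.inr rfl)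
  obtain ⟨s, hs, hsa, hsw⟩ := hG.exists_common_neighbor (c := p) (a := a) (b := w) (S := S) hap.symm
    hpw (by rintro rfl; omega) (by
      rintro s (⟨hs, hsn⟩ | rfl | rfl)
      · refine ⟨fun h => ?_, by rintro rfl; omega⟩
        have := hs.dist_le_dist_add_one h.symm
        omega
      · exact ⟨fun h => hbp h.symm, by rintro rfl; omega⟩
      · exact ⟨fun h => hrp.dist_ne_of_adj hG.1 h (hp.trans hq.symm),
          by rintro rfl; exact haq hap⟩) (by
      have hlow : ∀ v, G.Reachable r v → G.dist r v < n → v ∈ insert a (insert w S) :=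
        fun v hv hvn => Or.inr (Or.inr (Or.inl ⟨hv, hvn⟩))
      have hbT : b ∈ insert a (insert w S) := Or.inr (Or.inr hbS)
      have hqT : q ∈ insert a (insert w S) := Or.inr (Or.inr hqS)
      have h1 := reachable_restrictTo_root n a hra ha (T := insert a (insert w S)) (Or.inl rfl) hlow
      have h2 := reachable_restrictTo_root n b hrb hb hbT hlow
      have h3 : (G.restrictTo (insert a (insert w S))).Adj b q := ⟨hbq, hbT, hqT⟩
      have h4 : (G.restrictTo (insert a (insert w S))).Adj q w := ⟨hqw, hqT, Or.inr (Or.inl rfl)⟩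
      exact ((h1.trans h2.symm).trans h3.reachable).trans h4.reachable)
  rcases hs with ⟨hs, hsn⟩ | rfl | rfl
  · have := hs.dist_le_dist_add_one hsw
    omega
  · have := hrb.dist_le_dist_add_one hsw
    omega
  · exact haq hsa.symm

/-- In a chordal bipartite graph in which vertices with a common neighbor have the same degree,
each connected component is complete bipartite. -/
theorem IsChordalBipartite.dist_le_two {Ω : Type u} [Finite Ω] {G : SimpleGraph Ω}
    (hG : G.IsChordalBipartite)
    (hdeg : ∀ a p w, G.Adj a p → G.Adj p w → (G.neighborSet a).ncard = (G.neighborSet w).ncard)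
    {r v : Ω} (hv : G.Reachable r v) : G.dist r v ≤ 2 := by
  obtain ⟨w, hw, hmax⟩ := Set.exists_max_image {v | G.Reachable r v} (G.dist r)
    (Set.toFinite _) ⟨v, hv⟩
  refine (hmax v hv).trans ?_
  by_contra! hlt
  -- Distance at least 3 leaves room for two layers below `w` and one more below those.
  obtain ⟨n, hn⟩ : ∃ n, G.dist r w = (n + 1) + 2 := ⟨G.dist r w - 3, by omega⟩
  have hw : G.Reachable r w := hw
  have hlow : ∀ q, G.Adj w q → G.Reachable r q ∧ G.dist r q = n + 2 := by
    intro q hq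
    have hrq : G.Reachable r q := hw.trans hq.reachable
    refine ⟨hrq, ?_⟩
    have h1 := hmax q hrq
    have h2 := hw.dist_ne_of_adj hG.1 hq
    have h3 := hrq.dist_le_dist_add_one hq.symm
    omega
  let N : Ω → Set Ω := fun p => {a | G.Adj a p ∧ G.dist r a = n + 1}
  obtain ⟨p₀, hp₀, -, -⟩ := hw.exists_adj_dist_eq hn
  -- The lower neighborhoods `N` are pairwise comparable, so one of least size lies in all the
  -- others.
  obtain ⟨p, hp, hmin⟩ := Set.exists_min_image (G.neighborSet w) (fun p => (N p).ncard)
    (Set.toFinite _) ⟨p₀, hp₀.symm⟩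
  have hp : G.Adj w p := hp
  obtain ⟨a, hap, hra, ha⟩ := (hlow p hp).1.exists_adj_dist_eq (hlow p hp).2
  have hall : ∀ q, G.Adj w q → G.Adj a q := by
    intro q hq
    by_contra haq
    have hle := hmin q hq
    have : ∃ b ∈ N q, b ∉ N p := by
      by_contra! hsub
      have hss : N q ⊂ N p := by
        refine Set.ssubset_iff_subset_ne.2 ⟨hsub, fun h => ?_⟩
        have : a ∈ N q := h ▸ (⟨hap, ha⟩ : a ∈ N p)
        exact haq this.1
      have := Set.ncard_lt_ncard hss (Set.toFinite _)
      omega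
    obtain ⟨b, hb, hbp⟩ := this
    rcases hG.lower_neighbors_comparable hp.symm hq.symm hap hb.1 hra ha hb.2 (hlow p hp).2
      (hlow q hq).2 hn with h | h
    · exact haq h
    · exact hbp ⟨h, hb.2⟩
  obtain ⟨l, hla, -, hl⟩ := hra.exists_adj_dist_eq ha
  -- All neighbors of the farthest vertex `w` lie below it and are adjacent to `a`, which has the
  -- further neighbor `l`; this contradicts equality of degrees.
  have hss : G.neighborSet w ⊂ G.neighborSet a := by
    refine Set.ssubset_iff_of_subset hall |>.2 ⟨l, hla.symm, fun h => ?_⟩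
    have := (hlow l h).2
    omega
  have := Set.ncard_lt_ncard hss (Set.toFinite _)
  rw [hdeg a p w hap hp.symm] at this
  exact lt_irrefl _ this

/-! ### Equitable partitions. -/

/-- A partition of the vertices is equitable if vertices in the same class have the same number of
neighbors in each class. -/
def IsEquitable {Ω : Type u} (X : SimpleGraph Ω) (r : Setoid Ω) : Prop :=
  ∀ x x' z, r x x' → {u | X.Adj x u ∧ r u z}.ncard = {u | X.Adj x' u ∧ r u z}.ncard

theorem IsEquitable.exists_adj {Ω : Type u} [Finite Ω] {X : SimpleGraph Ω} {r : Setoid Ω}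
    (hr : X.IsEquitable r) {x x' z : Ω} (hx : r x x') (hz : X.Adj x z) :
    ∃ z', r z' z ∧ X.Adj x' z' := by
  have h := hr x x' z hx
  have : {u | X.Adj x u ∧ r u z}.ncard ≠ 0 :=
    Set.ncard_ne_zero_of_mem (a := z) ⟨hz, r.refl z⟩ (Set.toFinite _)
  rw [h] at this
  obtain ⟨u, hu⟩ := Set.nonempty_of_ncard_ne_zero this
  exact ⟨u, hu.2, hu.1⟩

/-- Between two classes of an equitable partition into independent sets, a chordal bipartite graph
is a disjoint union of complete bipartite graphs. -/
theorem IsEquitable.adj_of_common_neighbor {Ω : Type u} [Finite Ω] {X : SimpleGraph Ω}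
    {r : Setoid Ω} (hr : X.IsEquitable r) (hX : X.IsChordalBipartite)
    (hind : ∀ x x', r x x' → ¬ X.Adj x x') {y y' z u : Ω} (hy : r y y') (hu : r u z)
    (hyz : X.Adj y z) (hyz' : X.Adj y' z) (hyu : X.Adj y' u) : X.Adj y u := by
  have hne : ¬ r y z := fun h => hind _ _ h hyz
  -- The graph between the two classes. As the classes are independent, its induced cycles are
  -- induced in `X`, so it is chordal bipartite.
  let G : SimpleGraph Ω :=
    { Adj := fun p q => X.Adj p q ∧ ((r p y ∧ r q z) ∨ (r p z ∧ r q y))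
      symm := ⟨fun p q h => ⟨h.1.symm, h.2.symm.imp And.symm And.symm⟩⟩
      loopless := ⟨fun p h => X.loopless.irrefl p h.1⟩ }
  have hGX : G ≤ X := fun p q h => h.1
  have hmem : ∀ p q, G.Adj p q → r p y ∨ r p z := fun p q h => h.2.imp And.left And.left
  have hGadj : ∀ p q, (r p y ∨ r p z) → (r q y ∨ r q z) → X.Adj p q → G.Adj p q := by
    intro p q hp hq h
    rcases hp with hp | hp <;> rcases hq with hq | hq
    · exact absurd h (hind _ _ (r.trans hp (r.symm hq)))
    · exact ⟨h, Or.inl ⟨hp, hq⟩⟩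
    · exact ⟨h, Or.inr ⟨hp, hq⟩⟩
    · exact absurd h (hind _ _ (r.trans hp (r.symm hq)))
  have hG : G.IsChordalBipartite := by
    refine ⟨Colorable.mono_left hGX hX.1, ?_⟩
    rintro n hn ⟨f⟩
    refine hX.2 n hn ⟨⟨f.toEmbedding, ?_⟩⟩
    have hf : ∀ i, r (f i) y ∨ r (f i) z := by
      intro i
      obtain ⟨m, rfl⟩ : ∃ m, n = m + 2 := ⟨n - 2, by omega⟩
      have : (cycleGraph (m + 2)).Adj i (i + 1) := by
        rw [cycleGraph_adj]; right; simp
      exact hmem _ _ (f.map_adj_iff.2 this)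
    intro i j
    change X.Adj (f i) (f j) ↔ _
    rw [← f.map_adj_iff]
    exact ⟨hGadj _ _ (hf i) (hf j), fun h => h.1⟩
  have hny : ∀ p, r p y → G.neighborSet p = {u | X.Adj p u ∧ r u z} := by
    intro p hp
    ext q
    constructor
    · rintro ⟨h, h' | h'⟩
      · exact ⟨h, h'.2⟩
      · exact absurd (r.trans (r.symm hp) h'.1) hne
    · exact fun h => ⟨h.1, Or.inl ⟨hp, h.2⟩⟩
  have hnz : ∀ p, r p z → G.neighborSet p = {u | X.Adj p u ∧ r u y} := by
    intro p hp
    ext q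
    constructor
    · rintro ⟨h, h' | h'⟩
      · exact absurd (r.trans (r.symm h'.1) hp) hne
      · exact ⟨h, h'.2⟩
    · exact fun h => ⟨h.1, Or.inr ⟨hp, h.2⟩⟩
  have hdeg : ∀ a p w, G.Adj a p → G.Adj p w →
      (G.neighborSet a).ncard = (G.neighborSet w).ncard := by
    rintro a p w ⟨-, ⟨h1, h2⟩ | ⟨h1, h2⟩⟩ ⟨-, ⟨h3, h4⟩ | ⟨h3, h4⟩⟩
    · exact absurd (r.trans (r.symm h3) h2) hne
    · rw [hny a h1, hny w h4]
      exact hr _ _ _ (r.trans h1 (r.symm h4))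
    · rw [hnz a h1, hnz w h4]
      exact hr _ _ _ (r.trans h1 (r.symm h4))
    · exact absurd (r.trans (r.symm h2) h3) hne
  have g1 : G.Adj y z := ⟨hyz, Or.inl ⟨r.refl y, r.refl z⟩⟩
  have g2 : G.Adj y' z := ⟨hyz', Or.inl ⟨r.symm hy, r.refl z⟩⟩
  have g3 : G.Adj y' u := ⟨hyu, Or.inl ⟨r.symm hy, hu⟩⟩
  have hyy' : G.Reachable y y' := g1.reachable.trans g2.symm.reachable
  have hreach : G.Reachable y u := hyy'.trans g3.reachable
  have h2 := hG.dist_le_two hdeg hreach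
  have hle : G.dist y u ≠ 0 := fun h0 => by
    have := hreach.dist_eq_zero_iff.1 h0
    subst this
    exact hne hu
  have h3 := hyy'.dist_ne_of_adj hG.1 g3
  have h4 : G.dist y y' ≤ 2 := hG.dist_le_two hdeg hyy'
  have h5 : G.dist y y' ≠ 1 := fun h => by
    rcases (dist_eq_one_iff_adj.1 h).2 with h | h
    · exact hne (r.trans hy h.2)
    · exact hne h.1
  -- Distances are at most 2, and parity separates `u` from the class of `y`.
  have h6 : G.dist y u = 1 := by
    by_contra h1
    have h7 : G.dist y u = 2 := by omega
    have h8 : G.dist y y' = 0 := by omega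
    have := hyy'.dist_eq_zero_iff.1 h8
    subst this
    rw [dist_eq_one_iff_adj.2 g3] at h7
    omega
  exact (dist_eq_one_iff_adj.1 h6).1

end SimpleGraph

/-! ### Structure of rooted equitable partitions. -/

namespace SimpleGraph

/-- An equitable partition of a connected chordal bipartite graph without induced bipartite claws
such that `α` forms a class by itself. -/
structure IsRootedPartition {Ω : Type u} (X : SimpleGraph Ω) (α : Ω) (r : Setoid Ω) : Prop where
  connected : X.Connected
  chordal : X.IsChordalBipartite
  claw : ¬ bipartiteClaw.IsIndContained X
  equitable : X.IsEquitable r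
  root : ∀ x, r α x → x = α

namespace IsRootedPartition

theorem not_adj_of_dist_eq {Ω : Type u} {X : SimpleGraph Ω} {α : Ω} {r : Setoid Ω}
    (h : X.IsRootedPartition α r) {x x' : Ω} (hx : X.dist α x = X.dist α x') : ¬ X.Adj x x' :=
  fun hadj => (h.connected α x).dist_ne_of_adj h.chordal.1 hadj hx

variable {Ω : Type u} [Finite Ω] {X : SimpleGraph Ω} {α : Ω} {r : Setoid Ω}

/-- Equitability copies a lower neighbor of `x` to a neighbor of `x'` in the same class; the
induction starts because the root is alone in its class. -/
theorem dist_le (h : X.IsRootedPartition α r) (n : ℕ) :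
    ∀ x x', r x x' → X.dist α x = n → X.dist α x' ≤ n := by
  induction n with
  | zero =>
    intro x x' hx h0
    have := h.connected.dist_eq_zero_iff.1 h0
    subst this
    rw [h.root x' hx, dist_self]
  | succ n ih =>
    intro x x' hx hn
    obtain ⟨y, hyx, hy, hyn⟩ := (h.connected α x).exists_adj_dist_eq hn
    obtain ⟨y', hy', hadj⟩ := h.equitable.exists_adj hx hyx.symm
    have h1 := ih y y' (r.symm hy') hyn
    have h2 := (h.connected α y').dist_le_dist_add_one hadj.symm
    omega

theorem dist_eq (h : X.IsRootedPartition α r) {x x' : Ω} (hx : r x x') :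
    X.dist α x = X.dist α x' :=
  le_antisymm (h.dist_le _ _ _ (r.symm hx) rfl) (h.dist_le _ _ _ hx rfl)

theorem adj_of_common_neighbor (h : X.IsRootedPartition α r) {y y' z u : Ω} (hy : r y y')
    (hu : r u z) (hyz : X.Adj y z) (hyz' : X.Adj y' z) (hyu : X.Adj y' u) : X.Adj y u :=
  h.equitable.adj_of_common_neighbor h.chordal
    (fun _ _ hx => h.not_adj_of_dist_eq (h.dist_eq hx)) hy hu hyz hyz' hyu

/-- The graph between the classes of `y` and `z` has at most two connected components. -/
def AtMostTwo (X : SimpleGraph Ω) (r : Setoid Ω) (y z : Ω) : Prop :=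
  ∀ y₁ y₂ y₃ z₁ z₂ z₃, r y₁ y → r y₂ y → r y₃ y → r z₁ z → r z₂ z → r z₃ z →
    X.Adj y₁ z₁ → X.Adj y₂ z₂ → X.Adj y₃ z₃ → X.Adj y₁ z₂ ∨ X.Adj y₁ z₃ ∨ X.Adj y₂ z₃

/-- Components between two classes are complete bipartite, so adjacency across two edges goes both
ways. This is why `AtMostTwo` lists each pair of edges in one direction only. -/
theorem adj_cross (h : X.IsRootedPartition α r) {y₁ y₂ z₁ z₂ : Ω} (hy : r y₁ y₂) (hz : r z₁ z₂)
    (h₁ : X.Adj y₁ z₁) (h₂ : X.Adj y₂ z₂) (h₁₂ : X.Adj y₁ z₂) : X.Adj y₂ z₁ :=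
  h.adj_of_common_neighbor (r.symm hy) hz h₂ h₁₂ h₁

theorem atMostTwo_symm (h : X.IsRootedPartition α r) {y z : Ω} (hyz : AtMostTwo X r y z) :
    AtMostTwo X r z y := by
  intro z₁ z₂ z₃ y₁ y₂ y₃ hz₁ hz₂ hz₃ hy₁ hy₂ hy₃ h₁ h₂ h₃
  have t : ∀ {a b c}, r a c → r b c → r a b := fun h h' => r.trans h (r.symm h')
  rcases hyz y₁ y₂ y₃ z₁ z₂ z₃ hy₁ hy₂ hy₃ hz₁ hz₂ hz₃ h₁.symm h₂.symm h₃.symm with h' | h' | h'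
  · exact Or.inl (h.adj_cross (t hy₁ hy₂) (t hz₁ hz₂) h₁.symm h₂.symm h').symm
  · exact Or.inr (Or.inl (h.adj_cross (t hy₁ hy₃) (t hz₁ hz₃) h₁.symm h₃.symm h').symm)
  · exact Or.inr (Or.inr (h.adj_cross (t hy₂ hy₃) (t hz₂ hz₃) h₂.symm h₃.symm h').symm)

/-- Two vertices of a class with a common lower neighbor `v`, not adjacent to a third vertex of the
class, cannot have distinct private neighbors in an upper class. -/
theorem false_of_lower_neighbor (h : X.IsRootedPartition α r) {v d₁ d₂ d₃ g₁ g₂ w : Ω} {n : ℕ}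
    (hv : X.dist α v = n) (hd₁ : X.dist α d₁ = n + 1) (hg₁ : X.dist α g₁ = n + 2)
    (hd₁₂ : r d₁ d₂) (hd₁₃ : r d₁ d₃) (hg : r g₁ g₂) (hwv : r w v) (hvd₁ : X.Adj v d₁)
    (hvd₂ : X.Adj v d₂) (hwd₃ : X.Adj w d₃) (hvd₃ : ¬ X.Adj v d₃) (h₁ : X.Adj d₁ g₁)
    (h₂ : X.Adj d₂ g₂) (h₁₂ : ¬ X.Adj d₁ g₂) (h₂₁ : ¬ X.Adj d₂ g₁) : False := by
  have hd₂ : X.dist α d₂ = n + 1 := by rw [← h.dist_eq hd₁₂, hd₁]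
  have hg₂ : X.dist α g₂ = n + 2 := by rw [← h.dist_eq hg, hg₁]
  have hw : X.dist α w = n := by rw [h.dist_eq hwv, hv]
  have hfar : ∀ {x y}, X.Adj x y → X.dist α y ≤ X.dist α x + 1 := fun hxy =>
    (h.connected α _).dist_le_dist_add_one hxy
  rcases n with - | n
  · have e1 := h.connected.dist_eq_zero_iff.1 hv
    have e2 := h.connected.dist_eq_zero_iff.1 hw
    rw [← e2, e1] at hwd₃
    exact hvd₃ hwd₃
  · obtain ⟨u, huv, hru, hu⟩ := (h.connected α v).exists_adj_dist_eq hv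
    have hug : ∀ {g}, X.dist α g = n + 1 + 2 → ¬ X.Adj u g := fun hg hadj => by
      have := hfar hadj
      omega
    -- The third leg of a claw centered at `v` is `u`, `x`. If `u` is the root it has no lower
    -- neighbor, and `w` serves as `x`; otherwise a lower neighbor of `u` does.
    obtain ⟨x, hux, hx₁, hx₂⟩ : ∃ x, X.Adj u x ∧ ¬ X.Adj d₁ x ∧ ¬ X.Adj d₂ x := by
      rcases n with - | n
      · have := h.connected.dist_eq_zero_iff.1 hu
        subst this
        refine ⟨w, dist_eq_one_iff_adj.1 hw, fun hadj => ?_, fun hadj => ?_⟩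
        · exact hvd₃ (h.adj_of_common_neighbor (r.symm hwv) (r.symm hd₁₃) hvd₁ hadj.symm hwd₃)
        · exact hvd₃ (h.adj_of_common_neighbor (r.symm hwv)
            (r.trans (r.symm hd₁₃) hd₁₂) hvd₂ hadj.symm hwd₃)
      · obtain ⟨x, hxu, -, hx⟩ := hru.exists_adj_dist_eq hu
        refine ⟨x, hxu.symm, fun hadj => ?_, fun hadj => ?_⟩
        · have := hfar hadj.symm
          omega
        · have := hfar hadj.symm
          omega
    exact h.claw (isIndContained_bipartiteClaw h.chordal.1 huv.symm hvd₁ hvd₂ hux h₁ h₂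
      (hug hg₁) (hug hg₂) hx₁ h₁₂ hx₂ h₂₁)

/-- Suppose three components meet the lower class in `y₁`, `y₂`, `y₃`. By induction two of these
share a lower neighbor. If it is adjacent to the third as well, it is the center of a claw;
otherwise `false_of_lower_neighbor` applies. -/
theorem atMostTwo_of_dist (h : X.IsRootedPartition α r) (n : ℕ) :
    ∀ y z, X.dist α y = n → X.dist α z = n + 1 → AtMostTwo X r y z := by
  induction n with
  | zero =>
    intro y z hy _ y₁ y₂ y₃ z₁ z₂ z₃ hy₁ hy₂ _ _ _ _ _ h₂ _
    have e1 := h.connected.dist_eq_zero_iff.1 ((h.dist_eq hy₁).trans hy)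
    have e2 := h.connected.dist_eq_zero_iff.1 ((h.dist_eq hy₂).trans hy)
    left
    rwa [← e1, e2]
  | succ n ih =>
    intro y z hy hz y₁ y₂ y₃ z₁ z₂ z₃ hy₁ hy₂ hy₃ hz₁ hz₂ hz₃ h₁ h₂ h₃
    by_contra! hcon
    obtain ⟨h₁₂, h₁₃, h₂₃⟩ := hcon
    have t : ∀ {a b c}, r a c → r b c → r a b := fun h h' => r.trans h (r.symm h')
    have h₂₁ : ¬ X.Adj y₂ z₁ := fun h' => h₁₂ (h.adj_cross (t hy₂ hy₁) (t hz₂ hz₁) h₂ h₁ h')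
    have h₃₁ : ¬ X.Adj y₃ z₁ := fun h' => h₁₃ (h.adj_cross (t hy₃ hy₁) (t hz₃ hz₁) h₃ h₁ h')
    have h₃₂ : ¬ X.Adj y₃ z₂ := fun h' => h₂₃ (h.adj_cross (t hy₃ hy₂) (t hz₃ hz₂) h₃ h₂ h')
    obtain ⟨v, hvy, -, hv⟩ := (h.connected α y).exists_adj_dist_eq hy
    obtain ⟨v₁, hv₁, hv₁y⟩ := h.equitable.exists_adj (r.symm hy₁) hvy.symm
    obtain ⟨v₂, hv₂, hv₂y⟩ := h.equitable.exists_adj (r.symm hy₂) hvy.symm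
    obtain ⟨v₃, hv₃, hv₃y⟩ := h.equitable.exists_adj (r.symm hy₃) hvy.symm
    have hdy : ∀ {x}, r x y → X.dist α x = n + 1 := fun hx => (h.dist_eq hx).trans hy
    have hdz : ∀ {x}, r x z → X.dist α x = n + 1 + 1 := fun hx => (h.dist_eq hx).trans hz
    have hdv : ∀ {x}, r x v → X.dist α x = n := fun hx => (h.dist_eq hx).trans hv
    have hclaw : ∀ {c}, X.Adj c y₁ → X.Adj c y₂ → X.Adj c y₃ → False := fun hc₁ hc₂ hc₃ =>
      h.claw (isIndContained_bipartiteClaw h.chordal.1 hc₁ hc₂ hc₃ h₁ h₂ h₃ h₁₂ h₁₃ h₂₁ h₂₃ h₃₁ h₃₂)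
    rcases ih v y hv hy v₁ v₂ v₃ y₁ y₂ y₃ hv₁ hv₂ hv₃ hy₁ hy₂ hy₃ hv₁y.symm hv₂y.symm hv₃y.symm with
      h' | h' | h'
    · exact h.false_of_lower_neighbor (hdv hv₁) (hdy hy₁) (hdz hz₁) (t hy₁ hy₂) (t hy₁ hy₃)
        (t hz₁ hz₂) (t hv₃ hv₁) hv₁y.symm h' hv₃y.symm (fun hc => hclaw hv₁y.symm h' hc) h₁ h₂ h₁₂ h₂₁
    · exact h.false_of_lower_neighbor (hdv hv₁) (hdy hy₁) (hdz hz₁) (t hy₁ hy₃) (t hy₁ hy₂)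
        (t hz₁ hz₃) (t hv₂ hv₁) hv₁y.symm h' hv₂y.symm (fun hc => hclaw hv₁y.symm hc h') h₁ h₃ h₁₃ h₃₁
    · exact h.false_of_lower_neighbor (hdv hv₂) (hdy hy₂) (hdz hz₂) (t hy₂ hy₃) (t hy₂ hy₁)
        (t hz₂ hz₃) (t hv₁ hv₂) hv₂y.symm h' hv₁y.symm (fun hc => hclaw hc hv₂y.symm h') h₂ h₃ h₂₃ h₃₂

theorem atMostTwo_of_adj (h : X.IsRootedPartition α r) {y z : Ω} (hyz : X.Adj y z) :
    AtMostTwo X r y z := by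
  have h1 := (h.connected α y).dist_le_dist_add_one hyz
  have h2 := (h.connected α z).dist_le_dist_add_one hyz.symm
  have h3 := (h.connected α y).dist_ne_of_adj h.chordal.1 hyz
  rcases (by omega : X.dist α z = X.dist α y + 1 ∨ X.dist α y = X.dist α z + 1) with h4 | h4
  · exact h.atMostTwo_of_dist _ _ _ rfl h4
  · exact h.atMostTwo_symm (h.atMostTwo_of_dist _ _ _ rfl h4)

/-- If the graph between two classes is not complete bipartite, then vertices of one of them with a
common neighbor in the other have the same neighborhood. -/
theorem adj_of_not_complete (h : X.IsRootedPartition α r) {y y' y'' z u : Ω} (hy : r y y')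
    (hy'' : r y y'') (hyz : X.Adj y z) (hyz' : X.Adj y' z) (hyz'' : ¬ X.Adj y'' z)
    (hyu : X.Adj y u) : X.Adj y' u := by
  by_contra hyu'
  obtain ⟨z', hz', hy''z'⟩ := h.equitable.exists_adj hy'' hyz
  obtain ⟨u', hu', hy'u'⟩ := h.equitable.exists_adj hy hyu
  have hyz₁ : ¬ X.Adj y z' := fun hc =>
    hyz'' (h.adj_of_common_neighbor (r.symm hy'') (r.symm hz') hy''z' hc hyz)
  have hy'z₁ : ¬ X.Adj y' z' := fun hc =>
    hyz'' (h.adj_of_common_neighbor (r.trans (r.symm hy'') hy) (r.symm hz') hy''z' hc hyz')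
  have hyu₁ : ¬ X.Adj y u' := fun hc =>
    hyu' (h.adj_of_common_neighbor (r.symm hy) (r.symm hu') hy'u' hc hyu)
  -- The classes of `z` and `u` each split the class of `y` into two halves, `A`, `B` and `C`, `D`.
  -- All four have the same size.
  let A : Set Ω := {d | X.Adj z d ∧ r d y}
  let B : Set Ω := {d | X.Adj z' d ∧ r d y}
  let C : Set Ω := {d | X.Adj u d ∧ r d y}
  let D : Set Ω := {d | X.Adj u' d ∧ r d y}
  have hAB : A.ncard = B.ncard := h.equitable _ _ _ (r.symm hz')
  have hCD : C.ncard = D.ncard := h.equitable _ _ _ (r.symm hu')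
  have hABd : Disjoint A B := by
    refine Set.disjoint_left.2 fun d hA hB => hyz₁ ?_
    exact h.adj_of_common_neighbor (r.symm hA.2) hz' hyz hA.1.symm hB.1.symm
  have hCDd : Disjoint C D := by
    refine Set.disjoint_left.2 fun d hC hD => hyu₁ ?_
    exact h.adj_of_common_neighbor (r.symm hC.2) hu' hyu hC.1.symm hD.1.symm
  have hABu : ∀ d, r d y → d ∈ A ∪ B := by
    intro d hd
    obtain ⟨c, hc, hdc⟩ := h.equitable.exists_adj (r.symm hd) hyz
    rcases h.atMostTwo_of_adj hyz y y'' d z z' c (r.refl y) (r.symm hy'') hd (r.refl z) hz' hc hyz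
      hy''z' hdc with h' | h' | h'
    · exact absurd h' hyz₁
    · exact Or.inl ⟨(h.adj_cross (r.symm hd) (r.symm hc) hyz hdc h').symm, hd⟩
    · exact Or.inr ⟨(h.adj_cross (r.trans (r.symm hy'') (r.symm hd)) (r.trans hz' (r.symm hc))
        hy''z' hdc h').symm, hd⟩
  have hCDu : ∀ d, r d y → d ∈ C ∪ D := by
    intro d hd
    obtain ⟨c, hc, hdc⟩ := h.equitable.exists_adj (r.symm hd) hyu
    rcases h.atMostTwo_of_adj hyu y y' d u u' c (r.refl y) (r.symm hy) hd (r.refl u) hu' hc hyu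
      hy'u' hdc with h' | h' | h'
    · exact absurd h' hyu₁
    · exact Or.inl ⟨(h.adj_cross (r.symm hd) (r.symm hc) hyu hdc h').symm, hd⟩
    · exact Or.inr ⟨(h.adj_cross (r.trans (r.symm hy) (r.symm hd)) (r.trans hu' (r.symm hc))
        hy'u' hdc h').symm, hd⟩
  have hEq : A ∪ B = C ∪ D := by
    ext d
    exact ⟨fun hd => hCDu d (hd.elim And.right And.right),
      fun hd => hABu d (hd.elim And.right And.right)⟩
  have hAC : A.ncard = C.ncard := by
    have h1 := Set.ncard_union_eq hABd (Set.toFinite _) (Set.toFinite _)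
    have h2 := Set.ncard_union_eq hCDd (Set.toFinite _) (Set.toFinite _)
    rw [hEq] at h1
    omega
  -- A half other than `A` cannot fit inside `A`, so it meets `B`. Hence the two splittings cross,
  -- giving `y₃` in `B ∩ C` and `y₄` in `B ∩ D`.
  have hne : ∀ E : Set Ω, E.ncard = A.ncard → (∀ d ∈ E, r d y) → (∃ d ∈ A, d ∉ E) →
      ∃ d ∈ B, d ∈ E := by
    rintro E hE hEy ⟨d, hdA, hdE⟩
    by_contra! hcon
    have hss : E ⊂ A := Set.ssubset_iff_of_subset (fun c hc =>
      (hABu c (hEy c hc)).resolve_right fun hB => hcon c hB hc) |>.2 ⟨d, hdA, hdE⟩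
    have := Set.ncard_lt_ncard hss (Set.toFinite _)
    omega
  obtain ⟨y₃, hB₃, hC₃⟩ := hne C hAC.symm (fun d hd => hd.2)
    ⟨y', ⟨hyz'.symm, r.symm hy⟩, fun hc => hyu' hc.1.symm⟩
  obtain ⟨y₄, hB₄, hD₄⟩ := hne D (hCD.symm.trans hAC.symm) (fun d hd => hd.2)
    ⟨y, ⟨hyz.symm, r.refl y⟩, fun hc => hyu₁ hc.1.symm⟩
  have hzy₃ : ¬ X.Adj y₃ z := fun hc => Set.disjoint_left.1 hABd ⟨hc.symm, hB₃.2⟩ hB₃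
  have hzy₄ : ¬ X.Adj y₄ z := fun hc => Set.disjoint_left.1 hABd ⟨hc.symm, hB₄.2⟩ hB₄
  have hdy : ∀ {d}, r d y → ¬ X.Adj y d := fun hd =>
    h.not_adj_of_dist_eq (h.dist_eq (r.symm hd))
  -- The vertices `y, z, y', u', y₄, z', y₃, u` form a closed walk of length 8. Removing `y` leaves
  -- a path from `z` to `u` no inner vertex of which is adjacent to both.
  let S : Set Ω := {y', u', y₄, z', y₃}
  have hzu : z ≠ u := by
    rintro rfl
    exact hyu' hyz'
  have step : ∀ {T : Set Ω} {a b}, X.Adj a b → a ∈ T → b ∈ T → (X.restrictTo T).Reachable a b :=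
    fun hab ha hb => Adj.reachable (G := X.restrictTo _) ⟨hab, ha, hb⟩
  obtain ⟨s, hs, hsz, hsu⟩ := h.chordal.exists_common_neighbor (c := y) (a := z) (b := u) (S := S)
    hyz hyu hzu (by
      have n1 : u' ≠ y := by rintro rfl; exact hdy (r.symm hy) hy'u'.symm
      have n2 : z' ≠ y := by rintro rfl; exact hdy (r.symm hy'') hy''z'.symm
      rintro s (rfl | rfl | rfl | rfl | rfl)
      · exact ⟨hdy (r.symm hy), fun hc => hyu' (hc ▸ hyu)⟩
      · exact ⟨hyu₁, n1⟩
      · exact ⟨hdy hB₄.2, fun hc => hyu₁ (hc ▸ hD₄.1.symm)⟩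
      · exact ⟨hyz₁, n2⟩
      · exact ⟨hdy hB₃.2, fun hc => hyz₁ (hc ▸ hB₃.1.symm)⟩) (by
      have m : ∀ {s}, s ∈ S → s ∈ insert z (insert u S) := fun hs => Or.inr (Or.inr hs)
      have m1 : y' ∈ insert z (insert u S) := m (by simp [S])
      have m2 : u' ∈ insert z (insert u S) := m (by simp [S])
      have m3 : y₄ ∈ insert z (insert u S) := m (by simp [S])
      have m4 : z' ∈ insert z (insert u S) := m (by simp [S])
      have m5 : y₃ ∈ insert z (insert u S) := m (by simp [S])
      exact (((((step hyz'.symm (Or.inl rfl) m1).trans (step hy'u' m1 m2)).trans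
        (step hD₄.1 m2 m3)).trans (step hB₄.1.symm m3 m4)).trans (step hB₃.1 m4 m5)).trans
        (step hC₃.1.symm m5 (Or.inr (Or.inl rfl))))
  rcases hs with rfl | rfl | rfl | rfl | rfl
  · exact hyu' hsu
  · exact h.not_adj_of_dist_eq (h.dist_eq hu') hsu
  · exact hzy₄ hsz
  · exact h.not_adj_of_dist_eq (h.dist_eq hz') hsz
  · exact hzy₃ hsz

theorem neighborSet_eq_of_not_complete (h : X.IsRootedPartition α r) {y y' y'' z : Ω} (hy : r y y')
    (hy'' : r y y'') (hyz : X.Adj y z) (hyz' : X.Adj y' z) (hyz'' : ¬ X.Adj y'' z) :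
    X.neighborSet y = X.neighborSet y' := by
  ext u
  exact ⟨h.adj_of_not_complete hy hy'' hyz hyz' hyz'',
    h.adj_of_not_complete (r.symm hy) (r.trans (r.symm hy) hy'') hyz' hyz hyz''⟩

/-- The vertices of a class have at most two distinct neighborhoods. -/
theorem neighborSet_eq_or (h : X.IsRootedPartition α r) {y₁ y₂ y₃ : Ω} (h₁₂ : r y₁ y₂)
    (h₁₃ : r y₁ y₃) (hne₁ : X.neighborSet y₁ ≠ X.neighborSet y₂)
    (hne₂ : X.neighborSet y₁ ≠ X.neighborSet y₃) : X.neighborSet y₂ = X.neighborSet y₃ := by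
  obtain ⟨u, hu⟩ : ∃ u, ¬ (X.Adj y₁ u ↔ X.Adj y₂ u) := by
    by_contra! hcon
    exact hne₁ (Set.ext hcon)
  obtain ⟨z, hz⟩ : ∃ z, X.Adj y₁ z := by
    by_contra! hcon
    refine hu ⟨fun hc => absurd hc (hcon u), fun hc => ?_⟩
    obtain ⟨u', -, h'⟩ := h.equitable.exists_adj (r.symm h₁₂) hc
    exact absurd h' (hcon u')
  -- The vertex `u` separates `y₁` from `y₂` but may be adjacent to `y₂` only; `u₁` is a neighbor of
  -- `y₁` in its class.
  obtain ⟨u₁, hu₁, hy₁⟩ : ∃ u₁, r u₁ u ∧ X.Adj y₁ u₁ := by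
    by_cases hc : X.Adj y₁ u
    · exact ⟨u, r.refl u, hc⟩
    · exact h.equitable.exists_adj (r.symm h₁₂) (not_not.1 fun hc' => hu ⟨fun h => absurd h hc,
        fun h => absurd h hc'⟩)
  obtain ⟨u₂, hu₂, hy₂⟩ := h.equitable.exists_adj h₁₂ hy₁
  obtain ⟨u₃, hu₃, hy₃⟩ := h.equitable.exists_adj h₁₃ hy₁
  have n₁₂ : ∀ {v}, r v u → X.Adj y₁ v → X.Adj y₂ v → False := fun hv h1 h2 =>
    hu ⟨fun hc => h.adj_of_common_neighbor (r.symm h₁₂) (r.symm hv) h2 h1 hc,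
      fun hc => h.adj_of_common_neighbor h₁₂ (r.symm hv) h1 h2 hc⟩
  have hu₂' := r.trans hu₂ hu₁
  have hu₃' := r.trans hu₃ hu₁
  rcases h.atMostTwo_of_adj hy₁ y₁ y₂ y₃ u₁ u₂ u₃ (r.refl _) (r.symm h₁₂) (r.symm h₁₃) (r.refl _)
    hu₂ hu₃ hy₁ hy₂ hy₃ with h' | h' | h'
  · exact (n₁₂ hu₂' h' hy₂).elim
  · exact absurd (h.neighborSet_eq_of_not_complete h₁₃ h₁₂ h' hy₃ fun hc => n₁₂ hu₃' h' hc) hne₂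
  · exact h.neighborSet_eq_of_not_complete (r.trans (r.symm h₁₂) h₁₃) (r.symm h₁₂) h' hy₃
      fun hc => n₁₂ hu₃' hc h'

end IsRootedPartition

end SimpleGraph

/-! ### Algebraic isomorphisms acting on points. -/

theorem exists_equiv_of_ncard_fiber_eq {A : Type u} {B : Type v} {K : Type*} [Finite A] [Finite B]
    (k : A → K) (k' : B → K) (h : ∀ c, {x | k x = c}.ncard = {x | k' x = c}.ncard) :
    ∃ e : A ≃ B, ∀ x, k' (e x) = k x := by
  have h' : ∀ c, Nonempty ({x // k x = c} ≃ {x // k' x = c}) := fun c => Finite.card_eq.1 (h c)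
  let E := fun c => (h' c).some
  refine ⟨(Equiv.sigmaFiberEquiv k).symm.trans
    ((Equiv.sigmaCongrRight E).trans (Equiv.sigmaFiberEquiv k')), fun x => ?_⟩
  exact (E (k x) ⟨x, rfl⟩).2

namespace CoherentConfiguration

section Cell

variable {Ω : Type u} [Finite Ω] (𝒳 : CoherentConfiguration Ω)

/-- The basis relation containing a given pair. -/
def cell (p : Ω × Ω) : 𝒳.S :=
  ⟨{x | 𝒳.toSetoid x p}, by rw [← classes_toSetoid]; exact ⟨p, rfl⟩⟩

theorem mem_cell (p : Ω × Ω) : p ∈ (𝒳.cell p).1 := 𝒳.toSetoid.refl p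

theorem mem_iff_cell_eq (s : 𝒳.S) (p : Ω × Ω) : p ∈ s.1 ↔ 𝒳.cell p = s := by
  constructor
  · intro hp
    obtain ⟨s, hs⟩ := s
    rw [← classes_toSetoid] at hs
    obtain ⟨y, rfl⟩ := hs
    exact Subtype.ext (Set.ext fun x => ⟨fun h => 𝒳.toSetoid.trans h hp,
      fun h => 𝒳.toSetoid.trans h (𝒳.toSetoid.symm hp)⟩)
  · rintro rfl
    exact 𝒳.mem_cell p

theorem toSetoid_iff_cell_eq {p q : Ω × Ω} : 𝒳.toSetoid p q ↔ 𝒳.cell p = 𝒳.cell q :=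
  𝒳.mem_iff_cell_eq (𝒳.cell q) p

theorem exists_cell_eq (s : 𝒳.S) : ∃ p, 𝒳.cell p = s := by
  obtain ⟨p, hp⟩ : s.1.Nonempty := Set.nonempty_iff_ne_empty.2 fun h =>
    𝒳.isPartition.1 (h ▸ s.2)
  exact ⟨p, (𝒳.mem_iff_cell_eq s p).1 hp⟩

theorem eq_of_cell_eq_diag {x a b : Ω} (h : 𝒳.cell (a, b) = 𝒳.cell (x, x)) : a = b :=
  (isUnionOfBasis_iff 𝒳 _).1 𝒳.diagonal (x, x) (a, b)
    (𝒳.toSetoid.symm (𝒳.toSetoid_iff_cell_eq.2 h)) rfl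

theorem cell_swap {x y x' y' : Ω} (h : 𝒳.cell (x, y) = 𝒳.cell (x', y')) :
    𝒳.cell (y, x) = 𝒳.cell (y', x') :=
  𝒳.toSetoid_iff_cell_eq.1 (𝒳.toSetoid_swap (𝒳.toSetoid_iff_cell_eq.2 h))

/-- Makes the lemmas on algebraic isomorphisms available inside a single configuration. -/
theorem isAlgebraicIso_refl : IsAlgebraicIso 𝒳 𝒳 (Equiv.refl 𝒳.S) :=
  fun r s t p hp q hq => 𝒳.coherent _ r.2 _ s.2 _ t.2 p hp q hq

end Cell

namespace IsAlgebraicIso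

variable {Ω : Type u} {Ω' : Type v} [Finite Ω] [Finite Ω'] {𝒳 : CoherentConfiguration Ω}
  {𝒳' : CoherentConfiguration Ω'} {φ : 𝒳.S ≃ 𝒳'.S}

/-- Triangles on corresponding pairs are in bijection. -/
theorem exists_equiv (hφ : IsAlgebraicIso 𝒳 𝒳' φ) {x y : Ω} {a b : Ω'}
    (h : φ (𝒳.cell (x, y)) = 𝒳'.cell (a, b)) :
    ∃ e : Ω ≃ Ω', ∀ z, φ (𝒳.cell (x, z)) = 𝒳'.cell (a, e z) ∧
      φ (𝒳.cell (z, y)) = 𝒳'.cell (e z, b) := by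
  obtain ⟨e, he⟩ := exists_equiv_of_ncard_fiber_eq
    (fun z => (φ (𝒳.cell (x, z)), φ (𝒳.cell (z, y))))
    (fun z => (𝒳'.cell (a, z), 𝒳'.cell (z, b))) (by
      rintro ⟨s', t'⟩
      obtain ⟨s, rfl⟩ := φ.surjective s'
      obtain ⟨t, rfl⟩ := φ.surjective t'
      have := hφ s t (𝒳.cell (x, y)) (x, y) (𝒳.mem_cell _) (a, b) (by rw [h]; exact 𝒳'.mem_cell _)
      simp only [pathCount, mem_iff_cell_eq] at this
      simpa only [Prod.mk.injEq, φ.injective.eq_iff] using this)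
  exact ⟨e, fun z => ⟨(congrArg Prod.fst (he z)).symm, (congrArg Prod.snd (he z)).symm⟩⟩

theorem exists_right (hφ : IsAlgebraicIso 𝒳 𝒳' φ) {x y : Ω} {a b : Ω'}
    (h : φ (𝒳.cell (x, y)) = 𝒳'.cell (a, b)) (z : Ω) :
    ∃ c, φ (𝒳.cell (x, z)) = 𝒳'.cell (a, c) ∧ φ (𝒳.cell (z, y)) = 𝒳'.cell (c, b) := by
  obtain ⟨e, he⟩ := hφ.exists_equiv h
  exact ⟨e z, he z⟩

theorem exists_left (hφ : IsAlgebraicIso 𝒳 𝒳' φ) {x y : Ω} {a b : Ω'}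
    (h : φ (𝒳.cell (x, y)) = 𝒳'.cell (a, b)) (c : Ω') :
    ∃ z, φ (𝒳.cell (x, z)) = 𝒳'.cell (a, c) ∧ φ (𝒳.cell (z, y)) = 𝒳'.cell (c, b) := by
  obtain ⟨e, he⟩ := hφ.exists_equiv h
  have := he (e.symm c)
  rw [e.apply_symm_apply] at this
  exact ⟨_, this⟩

/-- Lifting the point `a` to some `z` gives a pair $(z,x)$ in the basis relation of $(x,x)$, so
$z=x$, and then $(a,a)$ and $(a,b)$ share a basis relation. -/
theorem eq_of_diag (hφ : IsAlgebraicIso 𝒳 𝒳' φ) {x : Ω} {a b : Ω'}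
    (h : φ (𝒳.cell (x, x)) = 𝒳'.cell (a, b)) : a = b := by
  obtain ⟨z, hz₁, hz₂⟩ := hφ.exists_left h a
  have := 𝒳.eq_of_cell_eq_diag (φ.injective (hz₂.trans h.symm))
  subst this
  exact 𝒳'.eq_of_cell_eq_diag (h.symm.trans hz₁)

theorem diag_left (hφ : IsAlgebraicIso 𝒳 𝒳' φ) {x y : Ω} {a b : Ω'}
    (h : φ (𝒳.cell (x, y)) = 𝒳'.cell (a, b)) : φ (𝒳.cell (x, x)) = 𝒳'.cell (a, a) := by
  obtain ⟨c, hc, -⟩ := hφ.exists_right h x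
  rwa [← hφ.eq_of_diag hc] at hc

theorem diag_right (hφ : IsAlgebraicIso 𝒳 𝒳' φ) {x y : Ω} {a b : Ω'}
    (h : φ (𝒳.cell (x, y)) = 𝒳'.cell (a, b)) : φ (𝒳.cell (y, y)) = 𝒳'.cell (b, b) := by
  obtain ⟨c, -, hc⟩ := hφ.exists_right h y
  rwa [hφ.eq_of_diag hc] at hc

theorem eq_of_diag' (hφ : IsAlgebraicIso 𝒳 𝒳' φ) {x y : Ω} {a : Ω'}
    (h : φ (𝒳.cell (x, y)) = 𝒳'.cell (a, a)) : x = y :=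
  𝒳.eq_of_cell_eq_diag (φ.injective (h.trans (hφ.diag_left h).symm))

theorem swap (hφ : IsAlgebraicIso 𝒳 𝒳' φ) {x y : Ω} {a b : Ω'}
    (h : φ (𝒳.cell (x, y)) = 𝒳'.cell (a, b)) : φ (𝒳.cell (y, x)) = 𝒳'.cell (b, a) := by
  obtain ⟨z, hz₁, hz₂⟩ := hφ.exists_left (hφ.diag_left h) b
  rw [← hz₂, 𝒳.cell_swap (φ.injective (h.trans hz₁.symm))]

theorem exists_diag (hφ : IsAlgebraicIso 𝒳 𝒳' φ) (x : Ω) :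
    ∃ a, φ (𝒳.cell (x, x)) = 𝒳'.cell (a, a) := by
  obtain ⟨⟨a, b⟩, h⟩ := 𝒳'.exists_cell_eq (φ (𝒳.cell (x, x)))
  exact ⟨a, hφ.diag_left h.symm⟩

/-- If an algebraic isomorphism from the coherent closure of `T` agrees with a bijection `f` on
the relations of `T`, then it agrees with `f` on all basis relations. -/
theorem cell_eq_of_coherentClosure {T : Set (Set (Ω × Ω))} (h𝒳 : 𝒳 = coherentClosure T)
    (hφ : IsAlgebraicIso 𝒳 𝒳' φ) (f : Ω ≃ Ω')
    (hf : ∀ R ∈ T, ∀ p q, φ (𝒳.cell p) = 𝒳'.cell (q.map f f) → (p ∈ R ↔ q ∈ R)) {p q : Ω × Ω}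
    (hpq : φ (𝒳.cell p) = 𝒳'.cell (q.map f f)) : 𝒳.cell p = 𝒳.cell q := by
  -- If `f` induced `φ`, then `rel` would relate only pairs in the same basis relation. The classes
  -- of the generated equivalence form a coherent configuration respecting `T`, so by minimality
  -- each class lies in a basis relation of `𝒳`.
  let rel : Ω × Ω → Ω × Ω → Prop := fun p q => φ (𝒳.cell p) = 𝒳'.cell (q.map f f)
  let e : Setoid (Ω × Ω) := Relation.EqvGen.setoid rel
  have hrel : ∀ {p q}, rel p q → e p q := fun h => Relation.EqvGen.rel _ _ h
  have hind : ∀ {P : Ω × Ω → Ω × Ω → Prop}, Equivalence P → (∀ p q, rel p q → P p q) →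
      ∀ p q, e p q → P p q := by
    intro P hP h p q hpq
    induction hpq with
    | rel _ _ h' => exact h _ _ h'
    | refl _ => exact hP.refl _
    | symm _ _ _ ih => exact hP.symm ih
    | trans _ _ _ _ _ ih₁ ih₂ => exact hP.trans ih₁ ih₂
  have hsat : ∀ R : Set (Ω × Ω), (∀ p q, rel p q → (p ∈ R ↔ q ∈ R)) →
      ∃ S ⊆ e.classes, R = ⋃₀ S := fun R hR =>
    (exists_sUnion_classes_iff e R).2 fun p q hpq =>
      (hind (P := fun p q => p ∈ R ↔ q ∈ R) ⟨fun _ => Iff.rfl, Iff.symm, Iff.trans⟩ hR p q hpq).1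
  let 𝒵 : CoherentConfiguration Ω :=
    { S := e.classes
      isPartition := Setoid.isPartition_classes e
      diagonal := by
        refine hsat _ ?_
        rintro ⟨x, y⟩ ⟨a, b⟩ h
        constructor
        · intro hxy
          have hxy : x = y := hxy
          subst hxy
          exact f.injective (hφ.eq_of_diag h)
        · intro hab
          have hab : a = b := hab
          subst hab
          exact hφ.eq_of_diag' h
      transpose := by
        have hsymm : ∀ p q, e p q → e p.swap q.swap :=
          hind (P := fun p q => e p.swap q.swap) ⟨fun _ => e.refl _, e.symm, e.trans⟩
            fun p q h => hrel (hφ.swap h)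
        rintro _ ⟨y, rfl⟩
        exact ⟨y.swap, Set.ext fun p => ⟨fun h => hsymm _ _ h, fun h => hsymm _ _ h⟩⟩
      coherent := by
        rintro _ ⟨r, rfl⟩ _ ⟨s, rfl⟩ _ ⟨t, rfl⟩ p hp q hq
        refine hind (P := fun p q => pathCount {x | e x r} {x | e x s} p =
          pathCount {x | e x r} {x | e x s} q) ⟨fun _ => rfl, Eq.symm, Eq.trans⟩ ?_ p q
          (e.trans hp (e.symm hq))
        rintro ⟨x, y⟩ ⟨a, b⟩ h
        -- The map $z \mapsto f^{-1}(g(z))$ carries the triangles on $(x,y)$ to those on $(a,b)$.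
        obtain ⟨g, hg⟩ := hφ.exists_equiv h
        have hz : ∀ z, e (x, z) (a, f.symm (g z)) ∧ e (z, y) (f.symm (g z), b) := by
          intro z
          refine ⟨hrel ?_, hrel ?_⟩
          · simpa [rel, Prod.map] using (hg z).1
          · simpa [rel, Prod.map] using (hg z).2
        refine Set.ncard_congr (fun z _ => f.symm (g z)) ?_ ?_ ?_
        · exact fun z hz' => ⟨e.trans (e.symm (hz z).1) hz'.1, e.trans (e.symm (hz z).2) hz'.2⟩
        · exact fun z z' _ _ h => g.injective (f.symm.injective h)
        · intro c hc
          have := hz (g.symm (f c))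
          rw [g.apply_symm_apply, f.symm_apply_apply] at this
          exact ⟨g.symm (f c), ⟨e.trans this.1 hc.1, e.trans this.2 hc.2⟩, by simp⟩ }
  have hle : 𝒳 ≤ 𝒵 := h𝒳 ▸ (isLeast_coherentClosure T).2 fun R hR => hsat R (hf R hR)
  rw [← toSetoid_iff_cell_eq]
  refine (le_iff_toSetoid_le _ _).1 hle ?_
  have : 𝒵.toSetoid = e := Setoid.mkClasses_classes e
  rw [this]
  exact hrel hpq

theorem induced_of_cell_eq (f : Ω ≃ Ω')
    (hf : ∀ p q : Ω × Ω, φ (𝒳.cell p) = 𝒳'.cell (q.map f f) → 𝒳.cell p = 𝒳.cell q) (s : 𝒳.S) :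
    (φ s).1 = Prod.map f f '' s.1 := by
  have key : ∀ q : Ω × Ω, φ (𝒳.cell q) = 𝒳'.cell (q.map f f) := by
    intro q
    obtain ⟨s, hs⟩ := φ.surjective (𝒳'.cell (q.map f f))
    obtain ⟨p, rfl⟩ := 𝒳.exists_cell_eq s
    rw [← hf p q hs, hs]
  ext q'
  obtain ⟨q, rfl⟩ := (f.prodCongr f).surjective q'
  change q.map f f ∈ _ ↔ q.map f f ∈ _
  rw [mem_iff_cell_eq, ← key, φ.injective.eq_iff, ← mem_iff_cell_eq,
    (f.injective.prodMap f.injective).mem_set_image]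

/-- Gluing the sections of an algebraic isomorphism at the points `ρ y` into one bijection. -/
theorem exists_equiv_of_basepoints (hφ : IsAlgebraicIso 𝒳 𝒳' φ) [Nonempty Ω] (ρ : Ω → Ω)
    (hρ : ∀ y z, 𝒳.cell (y, y) = 𝒳.cell (z, z) → ρ y = ρ z) :
    ∃ (f : Ω ≃ Ω') (b : Ω → Ω'), ∀ y, φ (𝒳.cell (ρ y, y)) = 𝒳'.cell (b (ρ y), f y) := by
  choose b hb using hφ.exists_diag
  choose e he using fun x => hφ.exists_equiv (hb x)
  let f : Ω → Ω' := fun y => e (ρ y) y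
  have hf : ∀ y, φ (𝒳.cell (ρ y, y)) = 𝒳'.cell (b (ρ y), f y) := fun y => (he (ρ y) y).1
  have hinj : Function.Injective f := by
    -- Equal images force equal fibers, hence equal basepoints, hence the same bijection `e (ρ y)`.
    intro y z hyz
    have h1 := hφ.diag_right (hf y)
    rw [hyz, ← hφ.diag_right (hf z)] at h1
    have h2 := hρ y z (φ.injective h1)
    have hyz : e (ρ y) y = e (ρ z) z := hyz
    rw [← h2] at hyz
    exact (e (ρ y)).injective hyz
  have hcard : Nat.card Ω = Nat.card Ω' := Nat.card_congr (e (Classical.arbitrary Ω))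
  have hbij : Function.Bijective f := (Nat.bijective_iff_injective_and_card f).2 ⟨hinj, hcard⟩
  exact ⟨Equiv.ofBijective f hbij, b, hf⟩

end IsAlgebraicIso

end CoherentConfiguration

/-! ### Linked fibers and separability. -/

namespace CoherentConfiguration

variable {Ω : Type u} [Finite Ω] (𝒳 : CoherentConfiguration Ω)

/-- The partition of the underlying set into fibers. -/
def fiberSetoid : Setoid Ω := Setoid.ker fun x => 𝒳.cell (x, x)

variable {𝒳} {X : SimpleGraph Ω}

theorem exists_third {x y x' y' : Ω} (h : 𝒳.cell (x, y) = 𝒳.cell (x', y')) (z : Ω) :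
    ∃ z', 𝒳.cell (x, z) = 𝒳.cell (x', z') ∧ 𝒳.cell (z, y) = 𝒳.cell (z', y') :=
  𝒳.isAlgebraicIso_refl.exists_right h z

theorem fiberSetoid_right {x y x' y' : Ω} (h : 𝒳.cell (x, y) = 𝒳.cell (x', y')) :
    𝒳.fiberSetoid y y' :=
  𝒳.isAlgebraicIso_refl.diag_right h

theorem isEquitable_fiberSetoid
    (hadj : ∀ p q : Ω × Ω, 𝒳.cell p = 𝒳.cell q → X.Adj p.1 p.2 → X.Adj q.1 q.2) :
    X.IsEquitable 𝒳.fiberSetoid := by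
  intro x x' z hx
  obtain ⟨e, he⟩ := 𝒳.isAlgebraicIso_refl.exists_equiv (x := x) (y := x) (a := x') (b := x') hx
  have he : ∀ u, 𝒳.cell (x, u) = 𝒳.cell (x', e u) := fun u => (he u).1
  refine Set.ncard_congr (fun u _ => e u) ?_ (fun u v _ _ h => e.injective h) ?_
  · exact fun u hu => ⟨hadj _ _ (he u) hu.1,
      Setoid.trans' _ (Setoid.symm' _ (fiberSetoid_right (he u))) hu.2⟩
  · intro v hv
    obtain ⟨u, rfl⟩ := e.surjective v
    exact ⟨u, ⟨hadj (x', e u) (x, u) (he u).symm hv.1,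
      Setoid.trans' _ (fiberSetoid_right (he u)) hv.2⟩, rfl⟩

/-- A vertex distinguishing `y'` from `z'` would transfer to a third point distinguishing `y` from
`z`. -/
theorem neighborSet_eq_of_cell_eq
    (hadj : ∀ p q : Ω × Ω, 𝒳.cell p = 𝒳.cell q → X.Adj p.1 p.2 → X.Adj q.1 q.2) {y z y' z' : Ω}
    (h : 𝒳.cell (y, z) = 𝒳.cell (y', z')) (hN : X.neighborSet y = X.neighborSet z) :
    X.neighborSet y' = X.neighborSet z' := by
  ext u'
  obtain ⟨u, hu₁, hu₂⟩ := exists_third h.symm u'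
  have hN : X.Adj y u ↔ X.Adj z u := Set.ext_iff.1 hN u
  have h1 : X.Adj y' u' ↔ X.Adj y u := ⟨hadj (y', u') (y, u) hu₁, hadj (y, u) (y', u') hu₁.symm⟩
  have h2 : X.Adj u' z' ↔ X.Adj u z := ⟨hadj (u', z') (u, z) hu₂, hadj (u, z) (u', z') hu₂.symm⟩
  change X.Adj y' u' ↔ X.Adj z' u'
  rw [h1, hN, X.adj_comm z' u', h2, X.adj_comm]

/-- Two fibers are linked if the graph between them is neither empty nor complete bipartite. -/
def IsLinked (𝒳 : CoherentConfiguration Ω) (X : SimpleGraph Ω) (y z : Ω) : Prop :=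
  ∃ y₁ z₁ y₂ z₂, 𝒳.fiberSetoid y₁ y ∧ 𝒳.fiberSetoid z₁ z ∧ 𝒳.fiberSetoid y₂ y ∧
    𝒳.fiberSetoid z₂ z ∧ X.Adj y₁ z₁ ∧ ¬ X.Adj y₂ z₂

theorem IsLinked.symm {y z : Ω} (h : IsLinked 𝒳 X y z) : IsLinked 𝒳 X z y := by
  obtain ⟨y₁, z₁, y₂, z₂, h₁, h₂, h₃, h₄, h₅, h₆⟩ := h
  exact ⟨z₁, y₁, z₂, y₂, h₂, h₁, h₄, h₃, h₅.symm, fun h => h₆ h.symm⟩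

/-- The equivalence relation generated by linked fibers. -/
def linkSetoid (𝒳 : CoherentConfiguration Ω) (X : SimpleGraph Ω) : Setoid Ω :=
  Relation.EqvGen.setoid fun y z => 𝒳.fiberSetoid y z ∨ IsLinked 𝒳 X y z

/-- Within the fibers linked to that of `x`, the neighborhood of a vertex `y` is determined by the
basis relation of `(x, y)`. -/
theorem neighborSet_eq_of_linkSetoid {α : Ω} (h : X.IsRootedPartition α 𝒳.fiberSetoid)
    (hadj : ∀ p q : Ω × Ω, 𝒳.cell p = 𝒳.cell q → X.Adj p.1 p.2 → X.Adj q.1 q.2) {x y y' : Ω}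
    (hxy : linkSetoid 𝒳 X x y) (hyy' : 𝒳.cell (x, y) = 𝒳.cell (x, y')) :
    X.neighborSet y = X.neighborSet y' := by
  let r := 𝒳.fiberSetoid
  let Q : Ω → Prop := fun y => ∀ y₁ y₂, r y₁ y → 𝒳.cell (x, y₁) = 𝒳.cell (x, y₂) →
    X.neighborSet y₁ = X.neighborSet y₂
  -- With at most two neighborhoods in the fiber of `x`, all that matters is whether `y₁` is a twin
  -- of `x`, and the basis relation decides this.
  have hbase : Q x := by
    intro y₁ y₂ hy₁ hc
    have h₁₂ : r y₁ y₂ := fiberSetoid_right hc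
    by_cases h1 : X.neighborSet x = X.neighborSet y₁
    · exact h1.symm.trans (neighborSet_eq_of_cell_eq hadj hc h1)
    · exact h.neighborSet_eq_or (r.symm hy₁) (r.trans (r.symm hy₁) h₁₂) h1
        fun h2 => h1 (neighborSet_eq_of_cell_eq hadj hc.symm h2)
  have hfiber : ∀ y z, r y z → Q y → Q z := fun y z hyz hQ y₁ y₂ hy₁ hc =>
    hQ y₁ y₂ (r.trans hy₁ (r.symm hyz)) hc
  have hlink : ∀ y z, IsLinked 𝒳 X y z → Q y → Q z := by
    rintro y z ⟨y₁, z₁, y₂, z₂, hy₁, hz₁, hy₂, hz₂, hyz, hyz'⟩ hQ w₁ w₂ hw₁ hc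
    have hw : r w₁ w₂ := fiberSetoid_right hc
    obtain ⟨v₁, hv₁, hwv₁⟩ := h.equitable.exists_adj (r.trans hz₁ (r.symm hw₁)) hyz.symm
    obtain ⟨v₂, hv₂, hwv₂⟩ := exists_third hc v₁
    have hN : X.Adj v₁ w₂ ↔ X.Adj v₂ w₂ :=
      Set.ext_iff.1 (hQ v₁ v₂ (r.trans hv₁ hy₁) hv₂) w₂
    have hvw₂ : X.Adj v₁ w₂ := hN.2 (hadj (v₁, w₁) (v₂, w₂) hwv₂ hwv₁.symm)
    -- If `v₁` were adjacent to the whole fiber of `z`, its component would contain every vertex of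
    -- the fiber of `y`, and the graph between the fibers would be complete.
    obtain ⟨w₃, hw₃, hvw₃⟩ : ∃ w₃, r w₃ z ∧ ¬ X.Adj w₃ v₁ := by
      by_contra! hall
      have hyv : r y₁ y₂ := r.trans hy₁ (r.symm hy₂)
      obtain ⟨z₃, hz₃, hyz₃⟩ := h.equitable.exists_adj hyv hyz
      have hz₃' : r z₃ z := r.trans hz₃ hz₁
      exact hyz' (h.adj_of_common_neighbor (r.trans (r.symm hyv) (r.symm hv₁))
        (r.trans hz₂ (r.symm hz₃')) hyz₃ (hall z₃ hz₃').symm (hall z₂ hz₂).symm)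
    exact h.neighborSet_eq_of_not_complete hw (r.trans hw₁ (r.symm hw₃)) hwv₁ hvw₂.symm hvw₃
  have hQ : ∀ a b, linkSetoid 𝒳 X a b → (Q a ↔ Q b) := by
    intro a b hab
    induction hab with
    | rel a b hab =>
      rcases hab with hab | hab
      · exact ⟨hfiber _ _ hab, hfiber _ _ (r.symm hab)⟩
      · exact ⟨hlink _ _ hab, hlink _ _ hab.symm⟩
    | refl _ => exact Iff.rfl
    | symm _ _ _ ih => exact ih.symm
    | trans _ _ _ _ _ ih₁ ih₂ => exact ih₁.trans ih₂
  exact (hQ x y hxy).1 hbase y y' (r.refl y) hyy'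

/-- The coherent closure of the arcs of `X` and the root is separable if its fibers form a rooted
partition. -/
theorem isSeparable_of_isRootedPartition {α : Ω}
    (h𝒳 : 𝒳 = coherentClosure {{p : Ω × Ω | X.Adj p.1 p.2}, {(α, α)}})
    (hadj : ∀ p q : Ω × Ω, 𝒳.cell p = 𝒳.cell q → X.Adj p.1 p.2 → X.Adj q.1 q.2)
    (h : X.IsRootedPartition α 𝒳.fiberSetoid) : IsSeparable.{u, v} 𝒳 := by
  intro Ω' _ 𝒳' φ hφ
  have : Nonempty Ω := ⟨α⟩
  let r := 𝒳.fiberSetoid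
  let L := linkSetoid 𝒳 X
  let ρ : Ω → Ω := fun y => (Quotient.mk L y).out
  have hLρ : ∀ y, L (ρ y) y := fun y => Quotient.mk_out (s := L) y
  have hρ : ∀ {y z}, L y z → ρ y = ρ z := fun hyz => congrArg Quotient.out (Quotient.sound hyz)
  have hρr : ∀ y z, r y z ∨ IsLinked 𝒳 X y z → ρ y = ρ z := fun y z hyz =>
    hρ (Relation.EqvGen.rel y z hyz)
  obtain ⟨f, b, hf⟩ := hφ.exists_equiv_of_basepoints ρ fun y z hyz => hρr y z (Or.inl hyz)
  have hdiag : ∀ y, φ (𝒳.cell (y, y)) = 𝒳'.cell (f y, f y) := fun y => hφ.diag_right (hf y)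
  have hfib : ∀ y z, φ (𝒳.cell (z, z)) = 𝒳'.cell (f y, f y) → r z y := fun y z hz =>
    φ.injective (hz.trans (hdiag y).symm)
  have hcell : ∀ p q : Ω × Ω, φ (𝒳.cell p) = 𝒳'.cell (q.map f f) → 𝒳.cell p = 𝒳.cell q := by
    refine fun p q => hφ.cell_eq_of_coherentClosure h𝒳 f ?_
    rintro R (rfl | rfl) ⟨y₁, z₁⟩ ⟨y, z⟩ hyz
    · have hyz : φ (𝒳.cell (y₁, z₁)) = 𝒳'.cell (f y, f z) := hyz
      have hy : r y₁ y := hfib _ _ (hφ.diag_left hyz)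
      have hz : r z₁ z := hfib _ _ (hφ.diag_right hyz)
      change X.Adj y₁ z₁ ↔ X.Adj y z
      by_cases hyzρ : ρ y = ρ z
      -- Pull the common basepoint image back to `x`, then move `x` to `ρ y` and `z₁` to `z`. This
      -- takes `y₁` to some `y₂` with the same relation to `ρ y` as `y`, hence a twin of `y`.
      · obtain ⟨x, hx₁, hx₂⟩ := hφ.exists_left hyz (b (ρ y))
        have e1 : 𝒳.cell (x, y₁) = 𝒳.cell (ρ y, y) := φ.injective ((hφ.swap hx₁).trans (hf y).symm)
        have e2 : 𝒳.cell (x, z₁) = 𝒳.cell (ρ y, z) := by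
          refine φ.injective (hx₂.trans ?_)
          rw [hyzρ]
          exact (hf z).symm
        obtain ⟨y₂, hy₂, hyz₂⟩ := exists_third e2 y₁
        have hN : X.Adj y z ↔ X.Adj y₂ z :=
          Set.ext_iff.1 (neighborSet_eq_of_linkSetoid h hadj (hLρ y) (e1.symm.trans hy₂)) z
        rw [hN]
        exact ⟨hadj (y₁, z₁) (y₂, z) hyz₂, hadj (y₂, z) (y₁, z₁) hyz₂.symm⟩
      · have hnl : ¬ IsLinked 𝒳 X y z := fun hl => hyzρ (hρr y z (Or.inr hl))
        constructor
        · intro hadj'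
          by_contra hcon
          exact hnl ⟨y₁, z₁, y, z, hy, hz, r.refl y, r.refl z, hadj', hcon⟩
        · intro hadj'
          by_contra hcon
          exact hnl ⟨y, z, y₁, z₁, r.refl y, r.refl z, hy, hz, hadj', hcon⟩
    · have hyz : φ (𝒳.cell (y₁, z₁)) = 𝒳'.cell (f y, f z) := hyz
      simp only [Set.mem_singleton_iff, Prod.mk.injEq]
      constructor
      · rintro ⟨rfl, rfl⟩
        have := f.injective (hφ.eq_of_diag hyz)
        subst this
        exact ⟨h.root _ (hfib _ _ hyz), h.root _ (hfib _ _ hyz)⟩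
      · rintro ⟨rfl, rfl⟩
        have := hφ.eq_of_diag' hyz
        subst this
        have := h.root _ (r.symm (hfib _ _ hyz))
        exact ⟨this, this⟩
  have hind := IsAlgebraicIso.induced_of_cell_eq f hcell
  exact ⟨f, fun s hs => hind ⟨s, hs⟩ ▸ (φ ⟨s, hs⟩).2, hind⟩

end CoherentConfiguration

/-- The coherent configuration of a connected chordal bipartite `T₂`-free graph with distinguished
vertex is separable. -/
theorem theorem2 {Ω : Type u} [Finite Ω] (X : SimpleGraph Ω) (α : Ω)
    (hconn : X.Connected) (hchord : X.IsChordalBipartite)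
    (hT : ¬ bipartiteClaw.IsIndContained X) :
    CoherentConfiguration.IsSeparable.{u, v} (X.WL α) := by
  have hsat := fun R hR => ((X.WL α).isUnionOfBasis_iff R).1
    ((CoherentConfiguration.isLeast_coherentClosure
      {{p : Ω × Ω | X.Adj p.1 p.2}, {(α, α)}}).1 R hR)
  have hadj : ∀ p q : Ω × Ω, (X.WL α).cell p = (X.WL α).cell q → X.Adj p.1 p.2 → X.Adj q.1 q.2 :=
    fun p q hpq => hsat _ (Or.inl rfl) p q ((X.WL α).toSetoid_iff_cell_eq.2 hpq)
  refine CoherentConfiguration.isSeparable_of_isRootedPartition rfl hadj ⟨hconn, hchord, hT,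
    CoherentConfiguration.isEquitable_fiberSetoid hadj, fun x hx => ?_⟩
  exact congrArg Prod.fst (hsat {(α, α)} (Or.inr rfl) (α, α) (x, x)
    ((X.WL α).toSetoid_iff_cell_eq.2 hx) rfl)
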